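/- Let $\mathfrak S_n$ be the set of permutations of $[n]=\{1,\dots,n\}$ and $\mathbf x=\{x_1,x_2,\dots\}$. For $S\subseteq[n-1]$ let $$F_S=\sum x_{i_1}x_{i_2}\cdots x_{i_n}\in\mathbb R[[\mathbf x]],$$ the sum being over all $i_1\le i_2\le\dots\le i_n$ with $i_j<i_{j+1}$ whenever $j\in S$. For a set of permutations $\Pi$ let $$Q_n(\Pi)=\sum_{\sigma}F_{\mathrm{Des}\,\sigma},$$ the sum being over all $\sigma\in\mathfrak S_n$ that avoid every $\pi\in\Pi$ in the sense of pattern avoidance, where $\mathrm{Des}\,\sigma=\{i\mid\sigma_i>\sigma_{i+1}\}$. For a standard Young tableau (SYT) $T$ with $k$ cells (English notation), let $K(T)$ be its Knuth class, i.e. the set of all $\pi\in\mathfrak S_k$ whose insertion tableau under the Robinson--Schensted correspondence is $T$. Let $s_\lambda$ denote the Schur function of the partition $\lambda$. Given positive integers $r,s$, an $(r,s)$-ascending sequence in an SYT $P=(p_{i,j})$ is a sequence of its entries $$p_{1,r}=p_{i_1,j_1}<p_{i_2,j_2}<\dots<p_{i_s,j_s}\quad\text{with}\quad 1=i_1<i_2<\dots<i_s$$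 (so if the first row of $P$ has fewer than $r$ cells, $P$ contains no such sequence). **Theorem.** Let $r,s\ge1$ and let $R$ be the row superstandard tableau of hook shape $(r,1^{s-1})$, that is, the SYT with first row $1,2,\dots,r$ and first column $1,r+1,r+2,\dots,r+s-1$. Then for every $n\ge0$ $$Q_n(K(R))=\sum_{\lambda\vdash n}c_\lambda s_\lambda,$$ where $c_\lambda$ is the number of SYT of shape $\lambda$ that contain no $(r,s)$-ascending sequence. -/

import Mathlib

/-!
Conventions.  Rows and columns of Young diagrams are numbered from `0`, as in Mathlib, while the
entries of a standard Young tableau with `n` cells are `1, …, n`.  A permutation in `𝔖ₙ` is a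
`σ : Equiv.Perm (Fin n)`; its one-line notation is the word `σ 0 + 1, …, σ (n - 1) + 1`.
Positions in words and the variables `x₀, x₁, …` are numbered from `0`.
-/

namespace HookExpansion

/-! ### Young diagrams and standard Young tableaux -/

/-- A standard Young tableau of shape `μ`: a bijective filling of the cells of `μ` with
`1, …, μ.card` whose rows and columns increase.  As for Mathlib's semistandard tableaux, the entry
function is set to `0` outside `μ`, so that equality of tableaux is equality of fillings. -/
@[ext]
structure SYT (μ : YoungDiagram) where
  /-- the entry in row `i` and column `j` -/
  entry : ℕ → ℕ → ℕ
  row_strict : ∀ {i j₁ j₂ : ℕ}, j₁ < j₂ → (i, j₂) ∈ μ → entry i j₁ < entry i j₂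
  col_strict : ∀ {i₁ i₂ j : ℕ}, i₁ < i₂ → (i₂, j) ∈ μ → entry i₁ j < entry i₂ j
  bijOn : Set.BijOn (fun c : ℕ × ℕ => entry c.1 c.2) (μ.cells : Set (ℕ × ℕ))
    (Finset.Icc 1 μ.card : Set ℕ)
  zeros : ∀ {i j : ℕ}, (i, j) ∉ μ → entry i j = 0

/-- The number of cells of `μ` in the rows above row `i`. -/
def rowOffset (μ : YoungDiagram) (i : ℕ) : ℕ := ∑ k ∈ Finset.range i, μ.rowLen k

theorem rowOffset_add_lt {μ : YoungDiagram} {i₁ i₂ j₁ j₂ : ℕ} (hi : i₁ < i₂) (h : (i₁, j₁) ∈ μ) :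
    rowOffset μ i₁ + j₁ < rowOffset μ i₂ + j₂ := by
  have h1 : rowOffset μ (i₁ + 1) ≤ rowOffset μ i₂ :=
    Finset.sum_le_sum_of_subset (Finset.range_mono hi)
  have h2 : rowOffset μ (i₁ + 1) = rowOffset μ i₁ + μ.rowLen i₁ := Finset.sum_range_succ _ _
  have h3 := YoungDiagram.mem_iff_lt_rowLen.1 h
  omega

theorem rowOffset_colLen (μ : YoungDiagram) : rowOffset μ (μ.colLen 0) = μ.card := by
  have h : ∀ c ∈ μ.cells, c.1 ∈ Finset.range (μ.colLen 0) := by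
    rintro ⟨i, j⟩ hc
    exact Finset.mem_range.2
      (YoungDiagram.mem_iff_lt_colLen.1 (μ.up_left_mem le_rfl (Nat.zero_le j) hc))
  rw [YoungDiagram.card, Finset.card_eq_sum_card_fiberwise h]
  exact Finset.sum_congr rfl fun i _ => μ.rowLen_eq_card

/-- The row superstandard tableau of shape `μ`: the rows are filled from top to bottom, each from
left to right, with `1, 2, 3, …` in order. -/
def rowSuperstandard (μ : YoungDiagram) : SYT μ where
  entry i j := if (i, j) ∈ μ then rowOffset μ i + j + 1 else 0
  row_strict {i j₁ j₂} hj h := by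
    rw [if_pos h, if_pos (μ.up_left_mem le_rfl hj.le h)]
    omega
  col_strict {i₁ i₂ j} hi h := by
    have h' := μ.up_left_mem hi.le le_rfl h
    rw [if_pos h, if_pos h']
    have := rowOffset_add_lt (j₂ := j) hi h'
    omega
  bijOn := by
    have hmaps : Set.MapsTo
        (fun c : ℕ × ℕ => if (c.1, c.2) ∈ μ then rowOffset μ c.1 + c.2 + 1 else 0)
        (μ.cells : Set (ℕ × ℕ)) (Finset.Icc 1 μ.card : Set ℕ) := by
      rintro ⟨i, j⟩ hc
      have hc' : (i, j) ∈ μ := hc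
      have h0 : i < μ.colLen 0 :=
        YoungDiagram.mem_iff_lt_colLen.1 (μ.up_left_mem le_rfl (Nat.zero_le j) hc')
      have := rowOffset_add_lt (j₂ := 0) h0 hc'
      rw [rowOffset_colLen] at this
      simp only [if_pos hc', Finset.coe_Icc, Set.mem_Icc]
      omega
    have hinj : Set.InjOn
        (fun c : ℕ × ℕ => if (c.1, c.2) ∈ μ then rowOffset μ c.1 + c.2 + 1 else 0)
        (μ.cells : Set (ℕ × ℕ)) := by
      rintro ⟨i, j⟩ hc ⟨i', j'⟩ hc' h
      have hc₁ : (i, j) ∈ μ := hc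
      have hc₂ : (i', j') ∈ μ := hc'
      simp only [if_pos hc₁, if_pos hc₂] at h
      rcases lt_trichotomy i i' with hi | rfl | hi
      · have := rowOffset_add_lt (j₂ := j') hi hc₁
        omega
      · simp only [Prod.mk.injEq, true_and]
        omega
      · have := rowOffset_add_lt (j₂ := j) hi hc₂
        omega
    exact ⟨hmaps, hinj, Finset.surjOn_of_injOn_of_card_le _ hmaps hinj (by simp)⟩
  zeros h := if_neg h

/-- The hook `(r, 1^{s-1})`, for positive `r` and `s`: a first row of `r` cells and a first column
of `s` cells. -/
def hook (r s : ℕ) : YoungDiagram where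
  cells := ({0} : Finset ℕ) ×ˢ Finset.range r ∪ Finset.range s ×ˢ ({0} : Finset ℕ)
  isLowerSet := by
    rintro ⟨i₂, j₂⟩ ⟨i₁, j₁⟩ ⟨hi : i₁ ≤ i₂, hj : j₁ ≤ j₂⟩ h
    simp only [Finset.coe_union, Finset.coe_product, Set.mem_union, Set.mem_prod, Finset.mem_coe,
      Finset.mem_singleton, Finset.mem_range] at h ⊢
    omega

/-- The Young diagram whose row lengths are the parts of `p`, in weakly decreasing order. -/
def partitionDiagram {n : ℕ} (p : n.Partition) : YoungDiagram :=
  YoungDiagram.ofRowLens (p.parts.sort (· ≥ ·)) (p.parts.pairwise_sort (· ≥ ·)).sortedGE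

/-- `P` contains an `(r, s)`-ascending sequence (for positive `r` and `s`): cells
`c 0, …, c (s - 1)` of the diagram, where `c 0` is the `r`-th cell of the first row, with strictly
increasing row indices and strictly increasing entries. -/
def SYT.HasAscendingSequence {μ : YoungDiagram} (P : SYT μ) (r s : ℕ) : Prop :=
  ∃ c : Fin s → ℕ × ℕ,
    (∀ k, c k ∈ μ) ∧ (∀ k : Fin s, (k : ℕ) = 0 → c k = (0, r - 1)) ∧
      StrictMono (fun k => (c k).1) ∧ StrictMono (fun k => P.entry (c k).1 (c k).2)

/-! ### Row insertion and Knuth classes -/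

/-- Row insertion of `x` into a row: `x` replaces the leftmost entry larger than `x`, which is
returned as the second component, or is appended to the row if there is no such entry. -/
def rowInsert (x : ℕ) : List ℕ → List ℕ × Option ℕ
  | [] => ([x], none)
  | y :: ys => if x < y then (x :: ys, some y) else (y :: (rowInsert x ys).1, (rowInsert x ys).2)

/-- Schensted insertion of `x` into a tableau given as the list of its rows, from top to bottom:
`x` is inserted into the first row, and the bumped entry, if any, into the remaining rows. -/
def tableauInsert (x : ℕ) : List (List ℕ) → List (List ℕ)
  | [] => [[x]]
  | row :: rows =>
    match rowInsert x row with
    | (row', none) => row' :: rows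
    | (row', some y) => row' :: tableauInsert y rows

/-- The one-line notation of a permutation, with values in `1, …, n`. -/
def oneLine {n : ℕ} (σ : Equiv.Perm (Fin n)) : List ℕ := List.ofFn fun i => (σ i : ℕ) + 1

/-- The `P`-tableau of `σ` under the Robinson–Schensted correspondence, as its list of rows. -/
def insertionTableau {n : ℕ} (σ : Equiv.Perm (Fin n)) : List (List ℕ) :=
  (oneLine σ).foldl (fun t x => tableauInsert x t) []

/-- The Knuth class `K(P)`: the permutations whose insertion tableau is `P`.  (Both sides of the
equation are `0` outside the respective shape and positive inside it.) -/
def knuthClass {μ : YoungDiagram} (P : SYT μ) : Set (Equiv.Perm (Fin μ.card)) :=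
  {σ | ∀ i j : ℕ, ((insertionTableau σ).getD i []).getD j 0 = P.entry i j}

/-! ### Pattern avoidance -/

/-- `σ` contains `π` as a pattern: some subsequence of `σ` is in the same relative order as `π`,
that is, its standardization is `π`. -/
def ContainsPattern {n k : ℕ} (σ : Equiv.Perm (Fin n)) (π : Equiv.Perm (Fin k)) : Prop :=
  ∃ f : Fin k → Fin n, StrictMono f ∧ ∀ a b : Fin k, σ (f a) < σ (f b) ↔ π a < π b

open Classical in
/-- `𝔖ₙ(Π)`: the permutations in `𝔖ₙ` that avoid every element of `Pi`. -/
noncomputable def avoiders (n : ℕ) {k : ℕ} (Pi : Set (Equiv.Perm (Fin k))) :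
    Finset (Equiv.Perm (Fin n)) :=
  {σ | ∀ π ∈ Pi, ¬ ContainsPattern σ π}

/-! ### Quasisymmetric and Schur functions -/

/-- The descent set of `σ`: the positions `i` with `σ i > σ (i + 1)`. -/
def descentSet {n : ℕ} (σ : Equiv.Perm (Fin n)) : Set ℕ :=
  {i | ∃ h : i + 1 < n, σ ⟨i + 1, h⟩ < σ ⟨i, Nat.lt_of_succ_lt h⟩}

/-- The fundamental quasisymmetric function `F_S` of degree `n`: the sum of the monomials
`x_{f 0} ⋯ x_{f (n-1)}` over all weakly increasing `f` such that `f j < f (j + 1)` for `j ∈ S`.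
The coefficient of a monomial is the number of such `f` producing it. -/
noncomputable def fundamental (n : ℕ) (S : Set ℕ) : MvPowerSeries ℕ ℝ := fun d =>
  (Nat.card {f : Fin n → ℕ // Monotone f ∧
    (∀ (j : ℕ) (h : j + 1 < n), j ∈ S → f ⟨j, Nat.lt_of_succ_lt h⟩ < f ⟨j + 1, h⟩) ∧
    ∑ j, Finsupp.single (f j) 1 = d} : ℝ)

/-- `Q_n(Π)`, the sum of `F_{Des σ}` over all `σ ∈ 𝔖ₙ(Π)`. -/
noncomputable def Q (n : ℕ) {k : ℕ} (Pi : Set (Equiv.Perm (Fin k))) : MvPowerSeries ℕ ℝ :=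
  ∑ σ ∈ avoiders n Pi, fundamental n (descentSet σ)

/-- The Schur function `s_μ`: the sum over all semistandard Young tableaux `T` of shape `μ` of the
product of `x_{T(c)}` over the cells `c`.  The coefficient of a monomial is the number of tableaux
with that content. -/
noncomputable def schur (μ : YoungDiagram) : MvPowerSeries ℕ ℝ := fun d =>
  (Nat.card {T : SemistandardYoungTableau μ //
    ∑ c ∈ μ.cells, Finsupp.single (T c.1 c.2) 1 = d} : ℝ)

/-- The number of standard Young tableaux of shape `μ` without an `(r, s)`-ascending sequence. -/
noncomputable def avoidingCount (r s : ℕ) (μ : YoungDiagram) : ℕ :=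
  Nat.card {P : SYT μ // ¬ P.HasAscendingSequence r s}

end HookExpansion

namespace HookExpansion

/-! ### Row insertion -/

theorem rowInsert_of_none {x : ℕ} : ∀ {l : List ℕ}, (rowInsert x l).2 = none →
    (rowInsert x l).1 = l ++ [x] ∧ ∀ a ∈ l, a ≤ x
  | [], _ => by simp [rowInsert]
  | a :: l, h => by
    by_cases hx : x < a
    · simp [rowInsert, hx] at h
    · simp only [rowInsert, if_neg hx] at h ⊢
      have := rowInsert_of_none h
      simp [this.1]
      exact ⟨by omega, this.2⟩

theorem rowInsert_eq_append {x : ℕ} : ∀ {l : List ℕ}, (∀ a ∈ l, a ≤ x) →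
    rowInsert x l = (l ++ [x], none)
  | [], _ => rfl
  | a :: l, h => by
    have ha : ¬ x < a := not_lt.2 (h a (by simp))
    simp [rowInsert, if_neg ha, rowInsert_eq_append fun b hb => h b (List.mem_cons_of_mem _ hb)]

theorem lt_of_rowInsert_eq_some {x y : ℕ} : ∀ {l : List ℕ}, (rowInsert x l).2 = some y → x < y
  | [], h => by simp [rowInsert] at h
  | a :: l, h => by
    by_cases hx : x < a
    · simp [rowInsert, hx] at h
      omega
    · simp only [rowInsert, if_neg hx] at h
      exact lt_of_rowInsert_eq_some h

theorem rowInsert_perm (x : ℕ) : ∀ l : List ℕ,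
    ((rowInsert x l).1 ++ (rowInsert x l).2.toList).Perm (x :: l)
  | [] => by simp [rowInsert]
  | a :: l => by
    by_cases hx : x < a
    · simp [rowInsert, hx]
    · simp only [rowInsert, if_neg hx, List.cons_append]
      exact ((rowInsert_perm x l).cons a).trans (List.Perm.swap _ _ _)

theorem length_rowInsert_of_some {x y : ℕ} {l : List ℕ} (h : (rowInsert x l).2 = some y) :
    (rowInsert x l).1.length = l.length := by
  have := (rowInsert_perm x l).length_eq
  simpa [h] using this

theorem mem_rowInsert {x a : ℕ} {l : List ℕ} (h : a ∈ (rowInsert x l).1) : a = x ∨ a ∈ l := by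
  have := (rowInsert_perm x l).subset (List.mem_append_left _ h)
  simpa using this

theorem mem_of_rowInsert_eq_some {x y : ℕ} {l : List ℕ} (h : (rowInsert x l).2 = some y) :
    y ∈ l := by
  have := (rowInsert_perm x l).subset (List.mem_append_right _ (b := y) (by simp [h]))
  have h' := lt_of_rowInsert_eq_some h
  simp only [List.mem_cons] at this
  rcases this with h1 | h1
  · omega
  · exact h1

theorem pairwise_rowInsert {x : ℕ} : ∀ {l : List ℕ}, l.Pairwise (· ≤ ·) →
    (rowInsert x l).1.Pairwise (· ≤ ·)
  | [], _ => by simp [rowInsert]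
  | a :: l, h => by
    rw [List.pairwise_cons] at h
    by_cases hx : x < a
    · simp only [rowInsert, if_pos hx, List.pairwise_cons]
      exact ⟨fun b hb => hx.le.trans (h.1 b hb), h.2⟩
    · simp only [rowInsert, if_neg hx, List.pairwise_cons]
      refine ⟨fun b hb => ?_, pairwise_rowInsert h.2⟩
      rcases mem_rowInsert hb with rfl | hb
      · omega
      · exact h.1 b hb

theorem exists_rowInsert_eq_cons (x : ℕ) (l : List ℕ) :
    ∃ h l', (rowInsert x l).1 = h :: l' ∧ h ≤ x := by
  cases l with
  | nil => exact ⟨x, [], rfl, le_rfl⟩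
  | cons a l =>
    by_cases hx : x < a
    · exact ⟨x, l, by simp [rowInsert, hx], le_rfl⟩
    · exact ⟨a, (rowInsert x l).1, by simp [rowInsert, hx], by omega⟩

theorem mem_rowInsert_self {x : ℕ} : ∀ l : List ℕ, x ∈ (rowInsert x l).1
  | [] => by simp [rowInsert]
  | a :: l => by
    by_cases hx : x < a
    · simp [rowInsert, hx]
    · simp [rowInsert, hx, mem_rowInsert_self l]

theorem rowInsert_injective {x₁ x₂ y : ℕ} : ∀ {l₁ l₂ : List ℕ}, l₁.Pairwise (· ≤ ·) →
    l₂.Pairwise (· ≤ ·) → (rowInsert x₁ l₁).2 = some y → (rowInsert x₂ l₂).2 = some y →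
    (rowInsert x₁ l₁).1 = (rowInsert x₂ l₂).1 → x₁ = x₂ ∧ l₁ = l₂
  | [], _, _, _, h, _, _ => by simp [rowInsert] at h
  | _ :: _, [], _, _, _, h, _ => by simp [rowInsert] at h
  | a₁ :: l₁, a₂ :: l₂, hl₁, hl₂, h₁, h₂, h => by
    rw [List.pairwise_cons] at hl₁ hl₂
    by_cases hx₁ : x₁ < a₁ <;> by_cases hx₂ : x₂ < a₂ <;>
      simp only [rowInsert, hx₁, hx₂, if_true, if_false, List.cons.injEq, Option.some.injEq]
        at h h₁ h₂ ⊢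
    · exact ⟨h.1, by omega, h.2⟩
    · have h3 := lt_of_rowInsert_eq_some h₂
      have h4 : x₂ ∈ l₁ := h.2 ▸ mem_rowInsert_self l₂
      have : a₁ ≤ x₂ := hl₁.1 _ h4
      exact absurd this (by omega)
    · have h3 := lt_of_rowInsert_eq_some h₁
      have h4 : x₁ ∈ l₂ := h.2 ▸ mem_rowInsert_self l₁
      have : a₂ ≤ x₁ := hl₂.1 _ h4
      exact absurd this (by omega)
    · have := rowInsert_injective hl₁.2 hl₂.2 h₁ h₂ h.2
      exact ⟨this.1, h.1, this.2⟩

/-- `Dom l l'`: the row `l'` can be placed below the row `l` in a tableau. -/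
def Dom : List ℕ → List ℕ → Prop
  | _, [] => True
  | [], _ :: _ => False
  | a :: l, b :: l' => a < b ∧ Dom l l'

@[simp] theorem dom_nil (l : List ℕ) : Dom l [] := by cases l <;> trivial

@[simp] theorem dom_nil_cons (b : ℕ) (l : List ℕ) : ¬ Dom [] (b :: l) := id

@[simp] theorem dom_cons_cons {a b : ℕ} {l l' : List ℕ} :
    Dom (a :: l) (b :: l') ↔ a < b ∧ Dom l l' := Iff.rfl

theorem dom_iff {l l' : List ℕ} : Dom l l' ↔ l'.length ≤ l.length ∧
    ∀ j (h : j < l.length) (h' : j < l'.length), l[j] < l'[j] := by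
  induction l generalizing l' with
  | nil => cases l' <;> simp
  | cons a l ih =>
    cases l' with
    | nil => simp
    | cons b l' =>
      rw [dom_cons_cons, ih]
      constructor
      · rintro ⟨h1, h2, h3⟩
        refine ⟨by simpa using h2, fun j h h' => ?_⟩
        cases j with
        | zero => simpa using h1
        | succ j => simpa using h3 j (by simpa using h) (by simpa using h')
      · rintro ⟨h1, h2⟩
        exact ⟨h2 0 (by simp) (by simp), by simpa using h1,
          fun j h h' => h2 (j + 1) (by simpa using h) (by simpa using h')⟩

theorem Dom.rowInsert_left {x : ℕ} : ∀ {l l' : List ℕ}, Dom l l' → Dom (rowInsert x l).1 l'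
  | _, [], _ => dom_nil _
  | a :: l, b :: l', h => by
    by_cases hx : x < a
    · simp only [rowInsert, if_pos hx]
      exact ⟨hx.trans h.1, h.2⟩
    · simp only [rowInsert, if_neg hx]
      exact ⟨h.1, h.2.rowInsert_left⟩

theorem Dom.rowInsert {x y : ℕ} : ∀ {l l' : List ℕ}, l.Pairwise (· ≤ ·) → Dom l l' →
    (rowInsert x l).2 = some y → Dom (rowInsert x l).1 (HookExpansion.rowInsert y l').1
  | [], _, _, _, h => by simp [HookExpansion.rowInsert] at h
  | a :: l, l', hl, hd, h => by
    rw [List.pairwise_cons] at hl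
    by_cases hx : x < a
    · simp only [HookExpansion.rowInsert, if_pos hx, Option.some.injEq] at h ⊢
      subst h
      cases l' with
      | nil => simpa [HookExpansion.rowInsert] using hx
      | cons b l' =>
        simp only [HookExpansion.rowInsert, if_pos hd.1]
        exact ⟨hx, hd.2⟩
    · have hy : a < y := hl.1 _ (mem_of_rowInsert_eq_some (by
        simpa [HookExpansion.rowInsert, hx] using h)) |>.lt_of_ne fun e => by
          have := lt_of_rowInsert_eq_some h
          omega
      simp only [HookExpansion.rowInsert, if_neg hx] at h ⊢
      cases l' with
      | nil => simpa [HookExpansion.rowInsert] using hy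
      | cons b l' =>
        by_cases hb : y < b
        · simp only [HookExpansion.rowInsert, if_pos hb]
          exact ⟨hy, hd.2.rowInsert_left⟩
        · simp only [HookExpansion.rowInsert, if_neg hb]
          exact ⟨hd.1, Dom.rowInsert hl.2 hd.2 h⟩

/-- Reverse row insertion, in a way compatible with the row below. -/
theorem exists_rowInsert_eq {y : ℕ} : ∀ {l l₂ : List ℕ}, l.Pairwise (· ≤ ·) →
    l₂.Pairwise (· ≤ ·) → (∃ a ∈ l.head?, a < y) → Dom l (rowInsert y l₂).1 →
    ∃ x l', rowInsert x l' = (l, some y) ∧ l'.Pairwise (· ≤ ·) ∧ Dom l' l₂ ∧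
      (∀ a ∈ l.head?, a ≤ x) ∧ ∀ a ∈ l.head?, ∀ b ∈ l', a ≤ b
  | [], _, _, _, h, _ => by simp at h
  | a :: l, l₂, hl, hl₂, ha, hd => by
    have hay : a < y := by simpa using ha
    rw [List.pairwise_cons] at hl
    by_cases hh : ∃ b ∈ l.head?, b < y
    · have hd' : Dom l (rowInsert y l₂.tail).1 := by
        obtain ⟨b, hb, hby⟩ := hh
        obtain ⟨l', rfl⟩ : ∃ l', l = b :: l' := by
          cases l with
          | nil => simp at hb
          | cons c l => exact ⟨l, by simp at hb; rw [hb]⟩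
        cases l₂ with
        | nil => simpa [rowInsert] using hby
        | cons c l₂ =>
          rw [List.pairwise_cons] at hl₂
          by_cases hc : y < c
          · simp only [rowInsert, if_pos hc] at hd
            cases l₂ with
            | nil => simpa [rowInsert] using hby
            | cons e l₂ =>
              have := hl₂.1 e (by simp)
              have he : y < e := by omega
              simp only [List.tail_cons, rowInsert, if_pos he]
              exact ⟨hby, hd.2.2⟩
          · simp only [rowInsert, if_neg hc] at hd
            exact hd.2
      obtain ⟨x, l', h1, h2, h3, h4, h5⟩ := exists_rowInsert_eq hl.2 hl₂.tail hh hd'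
      have hax : a ≤ x := by
        obtain ⟨b, hb, -⟩ := hh
        exact (hl.1 b (List.mem_of_mem_head? hb)).trans (h4 b hb)
      have hal : ∀ b ∈ l', a ≤ b := fun c hc => by
        obtain ⟨b, hb, -⟩ := hh
        exact (hl.1 b (List.mem_of_mem_head? hb)).trans (h5 b hb c hc)
      refine ⟨x, a :: l', by simp [rowInsert, h1, not_lt.2 hax], List.pairwise_cons.2 ⟨hal, h2⟩,
        ?_, by simpa using hax, by simpa using hal⟩
      cases l₂ with
      | nil => simp
      | cons c l₂ =>
        refine ⟨?_, h3⟩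
        by_cases hc : y < c
        · omega
        · simp only [rowInsert, if_neg hc] at hd
          exact hd.1
    · push Not at hh
      have hyl : ∀ b ∈ l, y ≤ b := by
        cases l with
        | nil => simp
        | cons c l =>
          have h0 : y ≤ c := hh c (by simp)
          have h1 := List.pairwise_cons.1 hl.2
          intro b hb
          rcases List.mem_cons.1 hb with rfl | hb
          · exact h0
          · exact h0.trans (h1.1 b hb)
      refine ⟨a, y :: l, by simp [rowInsert, hay], List.pairwise_cons.2 ⟨hyl, hl.2⟩, ?_,
        by simp, ?_⟩
      · cases l₂ with
        | nil => simp
        | cons c l₂ =>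
          by_cases hc : y < c
          · simp only [rowInsert, if_pos hc] at hd
            exact ⟨hc, hd.2⟩
          · simp only [rowInsert, if_neg hc] at hd
            obtain ⟨h, l', h1, h2⟩ := exists_rowInsert_eq_cons y l₂
            rw [h1] at hd
            cases l with
            | nil => exact absurd hd.2 (dom_nil_cons _ _)
            | cons e l =>
              have := hd.2.1
              have := hyl e (by simp)
              omega
      · intro c hc b hb
        simp only [List.head?_cons, Option.mem_def, Option.some.injEq] at hc
        subst hc
        rcases List.mem_cons.1 hb with rfl | hb
        · exact hay.le
        · exact hl.1 b hb

/-! ### Tableaux as lists of rows -/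

/-- A semistandard tableau, given as the list of its rows. -/
def IsTab : List (List ℕ) → Prop
  | [] => True
  | row :: rows => row ≠ [] ∧ row.Pairwise (· ≤ ·) ∧ Dom row (rows.headD []) ∧ IsTab rows

theorem IsTab.pairwise_headD {t : List (List ℕ)} (h : IsTab t) :
    (t.headD []).Pairwise (· ≤ ·) := by
  cases t with
  | nil => simp
  | cons row rows => exact h.2.1

/-- The index of the row where the insertion of `x` into a tableau ends. -/
def insRow : ℕ → List (List ℕ) → ℕ
  | _, [] => 0
  | x, row :: rows =>
    match (rowInsert x row).2 with
    | none => 0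
    | some y => insRow y rows + 1

section
variable {x y : ℕ} {row : List ℕ} {rows : List (List ℕ)}

theorem tableauInsert_of_none (h : (rowInsert x row).2 = none) :
    tableauInsert x (row :: rows) = (row ++ [x]) :: rows := by
  have h1 : rowInsert x row = (row ++ [x], none) := Prod.ext (rowInsert_of_none h).1 h
  simp [tableauInsert, h1]

theorem tableauInsert_of_some (h : (rowInsert x row).2 = some y) :
    tableauInsert x (row :: rows) = (rowInsert x row).1 :: tableauInsert y rows := by
  have h1 : rowInsert x row = ((rowInsert x row).1, some y) := Prod.ext rfl h
  rw [tableauInsert, h1]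

theorem insRow_of_none (h : (rowInsert x row).2 = none) : insRow x (row :: rows) = 0 := by
  simp [insRow, h]

theorem insRow_of_some (h : (rowInsert x row).2 = some y) :
    insRow x (row :: rows) = insRow y rows + 1 := by
  simp [insRow, h]

theorem headD_tableauInsert (x : ℕ) (t : List (List ℕ)) :
    (tableauInsert x t).headD [] = (rowInsert x (t.headD [])).1 := by
  cases t with
  | nil => rfl
  | cons row rows =>
    cases h : (rowInsert x row).2 with
    | none => simp [tableauInsert_of_none h, rowInsert_of_none h]
    | some y => simp [tableauInsert_of_some h]

end

theorem tableauInsert_flatten_perm (x : ℕ) (t : List (List ℕ)) :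
    (tableauInsert x t).flatten.Perm (x :: t.flatten) := by
  induction t generalizing x with
  | nil => simp [tableauInsert]
  | cons row rows ih =>
    have hp := rowInsert_perm x row
    cases h : (rowInsert x row).2 with
    | none =>
      rw [tableauInsert_of_none h]
      simp
    | some y =>
      rw [tableauInsert_of_some h]
      simp only [h, Option.toList_some] at hp
      simp only [List.flatten_cons]
      refine ((ih y).append_left _).trans ?_
      rw [← List.cons_append]
      refine List.Perm.trans ?_ (hp.append_right _)
      simp

theorem IsTab.tableauInsert {t : List (List ℕ)} (ht : IsTab t) (x : ℕ) :
    IsTab (tableauInsert x t) := by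
  induction t generalizing x with
  | nil => simp [HookExpansion.tableauInsert, IsTab]
  | cons row rows ih =>
    obtain ⟨h1, h2, h3, h4⟩ := ht
    cases h : (rowInsert x row).2 with
    | none =>
      have h5 := rowInsert_of_none h
      rw [tableauInsert_of_none h]
      refine ⟨by simp, h5.1 ▸ pairwise_rowInsert h2, h5.1 ▸ h3.rowInsert_left, h4⟩
    | some y =>
      rw [tableauInsert_of_some h]
      refine ⟨?_, pairwise_rowInsert h2, ?_, ih h4 y⟩
      · obtain ⟨_, _, h5, -⟩ := exists_rowInsert_eq_cons x row
        simp [h5]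
      · rw [headD_tableauInsert]
        exact Dom.rowInsert h2 h3 h

theorem length_getD_tableauInsert (x : ℕ) (t : List (List ℕ)) (i : ℕ) :
    ((tableauInsert x t).getD i []).length =
      (t.getD i []).length + if i = insRow x t then 1 else 0 := by
  induction t generalizing x i with
  | nil => cases i <;> simp [tableauInsert, insRow]
  | cons row rows ih =>
    cases h : (rowInsert x row).2 with
    | none => rw [tableauInsert_of_none h, insRow_of_none h]; cases i <;> simp
    | some y =>
      rw [tableauInsert_of_some h, insRow_of_some h]
      cases i with
      | zero => simp [length_rowInsert_of_some h]
      | succ i => simpa using ih y i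

theorem tableauInsert_ne_nil (x : ℕ) (t : List (List ℕ)) : tableauInsert x t ≠ [] := by
  intro h
  have := (tableauInsert_flatten_perm x t).length_eq
  simp [h] at this

theorem exists_rowInsert_eq_some {x y : ℕ} (hxy : x < y) : ∀ {l : List ℕ},
    l.Pairwise (· ≤ ·) → y ∈ l → ∃ z, (rowInsert x l).2 = some z ∧ z ≤ y
  | [], _, h => by simp at h
  | a :: l, hl, h => by
    rw [List.pairwise_cons] at hl
    by_cases hx : x < a
    · refine ⟨a, by simp [rowInsert, hx], ?_⟩
      rcases List.mem_cons.1 h with rfl | h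
      · exact le_rfl
      · exact hl.1 y h
    · rcases List.mem_cons.1 h with rfl | h
      · omega
      · simpa only [rowInsert, if_neg hx] using exists_rowInsert_eq_some hxy hl.2 h

theorem rowInsert_rowInsert_of_le {x y z : ℕ} (hxy : y ≤ x) : ∀ {l : List ℕ},
    l.Pairwise (· ≤ ·) → (rowInsert x (rowInsert y l).1).2 = some z →
      ∃ w, (rowInsert y l).2 = some w ∧ w ≤ z
  | [], _, h => by
    rw [rowInsert_eq_append (by simp : ∀ a ∈ [], a ≤ y), rowInsert_eq_append (by simpa)] at h
    simp at h
  | a :: l, hl, h => by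
    rw [List.pairwise_cons] at hl
    by_cases hy : y < a
    · refine ⟨a, by simp [rowInsert, hy], ?_⟩
      simp only [rowInsert, if_pos hy, if_neg (not_lt.2 hxy)] at h
      exact hl.1 z (mem_of_rowInsert_eq_some h)
    · have hx : ¬ x < a := by omega
      simp only [rowInsert, if_neg hy, if_neg hx] at h ⊢
      exact rowInsert_rowInsert_of_le hxy hl.2 h

/-- If `y ≤ x`, then inserting `y` and then `x` ends in weakly higher rows. -/
theorem insRow_tableauInsert_le {x y : ℕ} (hxy : y ≤ x) {t : List (List ℕ)} (ht : IsTab t) :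
    insRow x (tableauInsert y t) ≤ insRow y t := by
  induction t generalizing x y with
  | nil =>
    have := rowInsert_eq_append (x := x) (l := [y]) (by simpa)
    simp [tableauInsert, insRow, this]
  | cons row rows ih =>
    have h3 : ∀ z, _ := fun z => rowInsert_rowInsert_of_le (z := z) hxy ht.2.1
    cases h : (rowInsert y row).2 with
    | none =>
      rw [tableauInsert_of_none h, insRow_of_none h, insRow_of_none]
      by_contra h1
      obtain ⟨z, hz⟩ := Option.ne_none_iff_exists'.1 h1
      rw [← (rowInsert_of_none h).1] at hz
      obtain ⟨w, hw, -⟩ := h3 z hz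
      simp [h] at hw
    | some w =>
      rw [tableauInsert_of_some h, insRow_of_some h]
      cases h1 : (rowInsert x (rowInsert y row).1).2 with
      | none => simp [insRow_of_none h1]
      | some z =>
        rw [insRow_of_some h1]
        obtain ⟨w', hw, hwz⟩ := h3 z h1
        obtain rfl : w' = w := by simpa [h] using hw.symm
        exact Nat.succ_le_succ (ih hwz ht.2.2.2)

/-- If `x < y`, then inserting `y` and then `x` ends in strictly lower rows. -/
theorem insRow_lt_insRow_tableauInsert {x y : ℕ} (hxy : x < y) {t : List (List ℕ)}
    (ht : IsTab t) : insRow y t < insRow x (tableauInsert y t) := by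
  induction t generalizing x y with
  | nil => simp [tableauInsert, insRow, rowInsert, hxy]
  | cons row rows ih =>
    obtain ⟨z, hz, hzy⟩ :=
      exists_rowInsert_eq_some hxy (pairwise_rowInsert ht.2.1) (mem_rowInsert_self (x := y) row)
    cases h : (rowInsert y row).2 with
    | none =>
      rw [(rowInsert_of_none h).1] at hz
      rw [tableauInsert_of_none h, insRow_of_none h, insRow_of_some hz]
      omega
    | some w =>
      rw [tableauInsert_of_some h, insRow_of_some h, insRow_of_some hz]
      exact Nat.succ_lt_succ (ih (hzy.trans_lt (lt_of_rowInsert_eq_some h)) ht.2.2.2)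

/-! ### Reverse insertion -/

theorem tableauInsert_injective {x₁ x₂ : ℕ} {t₁ t₂ : List (List ℕ)} (h₁ : IsTab t₁)
    (h₂ : IsTab t₂) (h : tableauInsert x₁ t₁ = tableauInsert x₂ t₂)
    (hr : insRow x₁ t₁ = insRow x₂ t₂) : x₁ = x₂ ∧ t₁ = t₂ := by
  induction t₁ generalizing x₁ x₂ t₂ with
  | nil =>
    cases t₂ with
    | nil => simpa [tableauInsert] using h
    | cons r₂ t₂ =>
      cases g : (rowInsert x₂ r₂).2 with
      | none =>
        rw [tableauInsert_of_none g] at h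
        have := h₂.1
        simp only [tableauInsert, List.cons.injEq] at h
        have h3 := congrArg List.length h.1
        simp [this] at h3
      | some y => rw [insRow_of_some g] at hr; simp [insRow] at hr
  | cons r₁ t₁ ih =>
    cases g₁ : (rowInsert x₁ r₁).2 with
    | none =>
      cases t₂ with
      | nil =>
        rw [tableauInsert_of_none g₁] at h
        have := h₁.1
        simp only [tableauInsert, List.cons.injEq] at h
        have h3 := congrArg List.length h.1
        simp [this] at h3
      | cons r₂ t₂ =>
        cases g₂ : (rowInsert x₂ r₂).2 with
        | none =>
          rw [tableauInsert_of_none g₁, tableauInsert_of_none g₂] at h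
          simp only [List.cons.injEq, List.append_singleton_inj] at h
          exact ⟨h.1.2, by rw [h.1.1, h.2]⟩
        | some y => rw [insRow_of_none g₁, insRow_of_some g₂] at hr; omega
    | some y₁ =>
      rw [insRow_of_some g₁, tableauInsert_of_some g₁] at *
      cases t₂ with
      | nil => simp [insRow] at hr
      | cons r₂ t₂ =>
        cases g₂ : (rowInsert x₂ r₂).2 with
        | none => rw [insRow_of_none g₂] at hr; omega
        | some y₂ =>
          rw [insRow_of_some g₂] at hr
          rw [tableauInsert_of_some g₂] at h
          simp only [List.cons.injEq] at h
          obtain ⟨rfl, rfl⟩ := ih h₁.2.2.2 h₂.2.2.2 h.2 (by omega)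
          obtain ⟨rfl, rfl⟩ := rowInsert_injective h₁.2.1 h₂.2.1 g₁ g₂ h.1
          exact ⟨rfl, rfl⟩

theorem Dom.append_left {l l' : List ℕ} (h : Dom l l') (m : List ℕ) : Dom (l ++ m) l' := by
  rw [dom_iff] at h ⊢
  refine ⟨by simp; omega, fun j hj hj' => ?_⟩
  rw [List.getElem_append_left (by omega)]
  exact h.2 j _ hj'

theorem Dom.of_append_singleton {l l' : List ℕ} {x : ℕ} (h : Dom (l ++ [x]) l')
    (hl : l'.length < l.length + 1) : Dom l l' := by
  rw [dom_iff] at h ⊢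
  refine ⟨by omega, fun j hj hj' => ?_⟩
  have := h.2 j (by simp; omega) hj'
  rwa [List.getElem_append_left (by omega)] at this

/-- The entries of a tableau below its first row are larger than the first entry of that row. -/
theorem IsTab.head_lt {a : ℕ} {row : List ℕ} {rows : List (List ℕ)}
    (h : IsTab ((a :: row) :: rows)) :
    ∀ y ∈ rows.flatten, a < y := by
  induction rows generalizing a row with
  | nil => simp
  | cons row' rows ih =>
    obtain ⟨-, h2, h3, h4⟩ := h
    cases row' with
    | nil => exact absurd rfl h4.1
    | cons b row' =>
      have hab : a < b := h3.1
      intro y hy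
      rw [List.flatten_cons, List.mem_append] at hy
      rcases hy with hy | hy
      · rcases List.mem_cons.1 hy with rfl | hy
        · exact hab
        · exact hab.trans_le ((List.pairwise_cons.1 h4.2.1).1 y hy)
      · exact hab.trans (ih h4 y hy)

/-- Every corner of a tableau is the end of an insertion. -/
theorem exists_tableauInsert_eq {t : List (List ℕ)} (ht : IsTab t) {i : ℕ}
    (hi : (t.getD (i + 1) []).length < (t.getD i []).length) :
    ∃ x t', IsTab t' ∧ tableauInsert x t' = t ∧ insRow x t' = i := by
  induction t generalizing i with
  | nil => simp at hi
  | cons row rows ih =>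
    obtain ⟨h1, h2, h3, h4⟩ := ht
    cases i with
    | zero =>
      obtain ⟨l, x, rfl⟩ : ∃ l x, row = l ++ [x] :=
        ⟨_, _, (List.dropLast_append_getLast h1).symm⟩
      have hlx : ∀ a ∈ l, a ≤ x := fun a ha => by
        rw [List.pairwise_append] at h2
        exact h2.2.2 a ha x (by simp)
      have hlen : (rows.headD []).length < l.length + 1 := by
        cases rows with
        | nil => simp
        | cons row' rows => simpa using hi
      have hd := h3.of_append_singleton hlen
      rcases eq_or_ne l [] with rfl | hl
      · have : rows = [] := by
          cases rows with
          | nil => rfl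
          | cons r rows => cases r with
            | nil => exact absurd rfl h4.1
            | cons b r => exact absurd hd (dom_nil_cons _ _)
        subst this
        exact ⟨x, [], trivial, rfl, rfl⟩
      · have hr := rowInsert_eq_append hlx
        exact ⟨x, l :: rows, ⟨hl, (List.pairwise_append.1 h2).1, hd, h4⟩,
          tableauInsert_of_none (by rw [hr]), insRow_of_none (by rw [hr])⟩
    | succ i =>
      obtain ⟨y, t', ht', rfl, rfl⟩ := ih h4 (i := i) (by simpa using hi)
      rw [headD_tableauInsert] at h3
      obtain ⟨a, row, rfl⟩ := List.exists_cons_of_ne_nil h1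
      have hay : a < y := by
        refine IsTab.head_lt ⟨h1, h2, ?_, h4⟩ y
          ((tableauInsert_flatten_perm y t').mem_iff.2 (by simp))
        rwa [headD_tableauInsert]
      obtain ⟨x, l, hl, hls, hld, -⟩ :=
        exists_rowInsert_eq h2 ht'.pairwise_headD ⟨a, by simp, hay⟩ h3
      have hl2 : (rowInsert x l).2 = some y := by rw [hl]
      refine ⟨x, l :: t', ⟨?_, hls, hld, ht'⟩, ?_, insRow_of_some hl2⟩
      · rintro rfl
        simp [rowInsert] at hl2
      · rw [tableauInsert_of_some hl2, hl]

/-! ### The Robinson–Schensted–Knuth correspondence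

A biword is a list of pairs `(label, letter)`, written from right to left: its head is inserted
last. -/

/-- The length of row `i` of a list of rows. -/
def len (t : List (List ℕ)) (i : ℕ) : ℕ := (t.getD i []).length

theorem len_tableauInsert (x : ℕ) (t : List (List ℕ)) (i : ℕ) :
    len (tableauInsert x t) i = len t i + if i = insRow x t then 1 else 0 :=
  length_getD_tableauInsert x t i

theorem IsTab.len_succ_le {t : List (List ℕ)} (ht : IsTab t) (i : ℕ) : len t (i + 1) ≤ len t i := by
  induction t generalizing i with
  | nil => simp [len]
  | cons row rows ih =>
    cases i with
    | zero =>
      have := (dom_iff.1 ht.2.2.1).1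
      cases rows <;> simp_all [len]
    | succ i => simpa [len] using ih ht.2.2.2 i

theorem IsTab.len_antitone {t : List (List ℕ)} (ht : IsTab t) : Antitone (len t) :=
  antitone_nat_of_succ_le ht.len_succ_le

theorem IsTab.len_pos {t : List (List ℕ)} (ht : IsTab t) {i : ℕ} (hi : i < t.length) :
    0 < len t i := by
  induction t generalizing i with
  | nil => simp at hi
  | cons row rows ih =>
    cases i with
    | zero => simpa [len, List.length_pos_iff] using ht.1
    | succ i => simpa [len] using ih ht.2.2.2 (by simpa using hi)

/-- The insertion tableau of a biword. -/
def insTab (L : List (ℕ × ℕ)) : List (List ℕ) := L.foldr (fun p t => tableauInsert p.2 t) []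

/-- The recording tableau of a biword. -/
def recTab : List (ℕ × ℕ) → ℕ → ℕ → ℕ
  | [], _, _ => 0
  | p :: L, i, j =>
    if i = insRow p.2 (insTab L) ∧ j = len (insTab L) i then p.1 else recTab L i j

@[simp] theorem insTab_nil : insTab [] = [] := rfl

@[simp] theorem insTab_cons (p : ℕ × ℕ) (L : List (ℕ × ℕ)) :
    insTab (p :: L) = tableauInsert p.2 (insTab L) := rfl

theorem isTab_insTab (L : List (ℕ × ℕ)) : IsTab (insTab L) := by
  induction L with
  | nil => trivial
  | cons p L ih => exact ih.tableauInsert _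

theorem flatten_insTab_perm (L : List (ℕ × ℕ)) :
    (insTab L).flatten.Perm (L.map Prod.snd) := by
  induction L with
  | nil => simp
  | cons p L ih => exact (tableauInsert_flatten_perm _ _).trans (ih.cons _)

theorem recTab_eq_zero {L : List (ℕ × ℕ)} {i j : ℕ} (h : len (insTab L) i ≤ j) :
    recTab L i j = 0 := by
  induction L with
  | nil => rfl
  | cons p L ih =>
    rw [insTab_cons, len_tableauInsert] at h
    rw [recTab, if_neg, ih (by omega)]
    rintro ⟨rfl, rfl⟩
    simp at h

/-- Biwords in weakly increasing lexicographic order. -/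
def LexSorted (L : List (ℕ × ℕ)) : Prop :=
  L.Pairwise fun p q => q.1 < p.1 ∨ q.1 = p.1 ∧ q.2 ≤ p.2

/-- `q` is a semistandard filling of the shape of `t`, by `0` outside. -/
structure IsFilling (t : List (List ℕ)) (q : ℕ → ℕ → ℕ) : Prop where
  row_le : ∀ {i j₁ j₂}, j₁ < j₂ → j₂ < len t i → q i j₁ ≤ q i j₂
  col_lt : ∀ {i₁ i₂ j}, i₁ < i₂ → j < len t i₂ → q i₁ j < q i₂ j
  zeros : ∀ {i j}, len t i ≤ j → q i j = 0

/-- The label inserted last is the largest one, and it is in the topmost row with that label. -/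
theorem recTab_le {p : ℕ × ℕ} {L : List (ℕ × ℕ)} (hL : LexSorted (p :: L)) {i j : ℕ}
    (hj : j < len (insTab (p :: L)) i) : recTab (p :: L) i j ≤ p.1 ∧
      (recTab (p :: L) i j = p.1 → insRow p.2 (insTab L) ≤ i) := by
  induction L generalizing p i j with
  | nil =>
    rw [insTab_cons, len_tableauInsert] at hj
    simp only [recTab, len, insTab_nil] at hj ⊢
    split_ifs at hj <;> simp_all
  | cons p' L ih =>
    rw [insTab_cons, len_tableauInsert] at hj
    rw [recTab]
    split_ifs with h
    · exact ⟨le_rfl, fun _ => h.1.ge⟩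
    · have hj' : j < len (insTab (p' :: L)) i := by
        split_ifs at hj with hi
        · have := fun e => h ⟨hi, e⟩
          omega
        · exact hj
      have hL' := List.pairwise_cons.1 hL
      obtain ⟨h1, h2⟩ := ih hL'.2 hj'
      rcases hL'.1 p' (by simp) with h3 | ⟨h3, h4⟩
      · exact ⟨by omega, fun e => by omega⟩
      · refine ⟨by omega, fun e => ?_⟩
        exact (insRow_tableauInsert_le h4 (isTab_insTab L)).trans (h2 (by omega))

theorem recTab_cons_insRow (p : ℕ × ℕ) (L : List (ℕ × ℕ)) :
    recTab (p :: L) (insRow p.2 (insTab L)) (len (insTab L) (insRow p.2 (insTab L))) = p.1 := by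
  simp [recTab]

theorem isFilling_recTab {L : List (ℕ × ℕ)} (hL : LexSorted L) :
    IsFilling (insTab L) (recTab L) := by
  induction L with
  | nil => exact ⟨by simp [recTab], by simp [len], fun _ => rfl⟩
  | cons p L ih =>
    have hF := ih (List.pairwise_cons.1 hL).2
    have hT := isTab_insTab L
    refine ⟨fun {i j₁ j₂} hj h => ?_, fun {i₁ i₂ j} hi h => ?_, recTab_eq_zero⟩
    · have h1 := (recTab_le hL (hj.trans h)).1
      rw [insTab_cons, len_tableauInsert] at h
      by_cases hc : i = insRow p.2 (insTab L) ∧ j₂ = len (insTab L) i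
      · have : recTab (p :: L) i j₂ = p.1 := by rw [recTab, if_pos hc]
        omega
      · have hj₂ : j₂ < len (insTab L) i := by
          split_ifs at h with hi
          · have := fun e => hc ⟨hi, e⟩
            omega
          · exact h
        rw [recTab, recTab, if_neg hc, if_neg (by omega)]
        exact hF.row_le hj hj₂
    · have h0 := (isTab_insTab (p :: L)).len_antitone hi.le
      have h1 := recTab_le hL (h.trans_le h0)
      rw [insTab_cons, len_tableauInsert] at h h0
      have h2 := hT.len_antitone hi.le
      by_cases hc : i₂ = insRow p.2 (insTab L) ∧ j = len (insTab L) i₂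
      · have : recTab (p :: L) i₂ j = p.1 := by rw [recTab, if_pos hc]
        rw [this]
        refine h1.1.lt_of_ne fun e => ?_
        have := h1.2 e
        omega
      · have hj : j < len (insTab L) i₂ := by
          split_ifs at h with hi
          · have := fun e => hc ⟨hi, e⟩
            omega
          · exact h
        rw [recTab, recTab, if_neg hc, if_neg (by omega)]
        exact hF.col_lt hi hj

theorem rsk_injective {L₁ L₂ : List (ℕ × ℕ)} (h₁ : LexSorted L₁) (h₂ : LexSorted L₂)
    (hP : insTab L₁ = insTab L₂) (hQ : recTab L₁ = recTab L₂) : L₁ = L₂ := by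
  induction L₁ generalizing L₂ with
  | nil =>
    cases L₂ with
    | nil => rfl
    | cons p L => exact absurd hP.symm (tableauInsert_ne_nil _ _)
  | cons p₁ L₁ ih =>
    cases L₂ with
    | nil => exact absurd hP (tableauInsert_ne_nil _ _)
    | cons p₂ L₂ =>
      have key : ∀ {p₁ p₂ : ℕ × ℕ} {L₁ L₂ : List (ℕ × ℕ)}, LexSorted (p₁ :: L₁) →
          insTab (p₁ :: L₁) = insTab (p₂ :: L₂) → recTab (p₁ :: L₁) = recTab (p₂ :: L₂) →
          p₂.1 ≤ p₁.1 ∧ (p₂.1 = p₁.1 →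
            insRow p₁.2 (insTab L₁) ≤ insRow p₂.2 (insTab L₂)) := by
        intro p₁ p₂ L₁ L₂ h₁ hP hQ
        have := recTab_le h₁ (i := insRow p₂.2 (insTab L₂))
          (j := len (insTab L₂) (insRow p₂.2 (insTab L₂)))
          (by rw [hP, insTab_cons, len_tableauInsert, if_pos rfl]; omega)
        rwa [hQ, recTab_cons_insRow] at this
      have k1 := key h₁ hP hQ
      have k2 := key h₂ hP.symm hQ.symm
      have e1 : p₁.1 = p₂.1 := le_antisymm k2.1 k1.1
      have e2 := le_antisymm (k1.2 e1.symm) (k2.2 e1)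
      obtain ⟨e3, e4⟩ := tableauInsert_injective (isTab_insTab L₁) (isTab_insTab L₂) hP e2
      have e5 : recTab L₁ = recTab L₂ := by
        funext i j
        have := congrFun (congrFun hQ i) j
        rw [recTab, recTab, e4, e3] at this
        by_cases hc : i = insRow p₂.2 (insTab L₂) ∧ j = len (insTab L₂) i
        · rw [recTab_eq_zero (by rw [e4]; exact hc.2.ge), recTab_eq_zero hc.2.ge]
        · rwa [if_neg hc, if_neg hc] at this
      rw [ih (List.pairwise_cons.1 h₁).2 (List.pairwise_cons.1 h₂).2 e4 e5, Prod.ext e1 e3]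

theorem rsk_surjective {t : List (List ℕ)} (ht : IsTab t) {q : ℕ → ℕ → ℕ} (hq : IsFilling t q) :
    ∃ L, LexSorted L ∧ insTab L = t ∧ recTab L = q := by
  induction hn : t.flatten.length generalizing t q with
  | zero =>
    have : t = [] := by
      cases t with
      | nil => rfl
      | cons row rows =>
        have := List.length_pos_iff.2 ht.1
        rw [List.flatten_cons, List.length_append] at hn
        omega
    subst this
    refine ⟨[], List.Pairwise.nil, rfl, ?_⟩
    funext i j
    exact (hq.zeros (by simp [len])).symm
  | succ n ih =>
    have hfin : ∀ i, len t i ≠ 0 → i < t.length := fun i hi => by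
      by_contra h
      exact hi (by rw [len, List.getD_eq_default _ _ (not_lt.1 h), List.length_nil])
    have h0 : 0 < t.length := by
      rw [List.length_pos_iff]
      rintro rfl
      simp at hn
    -- the labels at the row ends
    let e : ℕ → ℕ := fun i => q i (len t i - 1)
    obtain ⟨k, hk, hmax⟩ := Finset.exists_max_image (Finset.range t.length) e
      ⟨0, Finset.mem_range.2 h0⟩
    have hex : ∃ i, i < t.length ∧ e i = e k := ⟨k, Finset.mem_range.1 hk, rfl⟩
    classical
    obtain ⟨hi, hik⟩ := Nat.find_spec hex
    have hmin : ∀ a, a < t.length → e a = e k → Nat.find hex ≤ a := fun a h1 h2 =>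
      Nat.find_min' hex ⟨h1, h2⟩
    generalize Nat.find hex = i at hi hik hmin
    have hle : ∀ {a b}, b < len t a → q a b ≤ e k := fun {a b} h => by
      have h1 : q a b ≤ e a := by
        rcases (show b ≤ len t a - 1 by omega).lt_or_eq with h2 | h2
        · exact hq.row_le h2 (by omega)
        · simp [e, h2]
      exact h1.trans (hmax a (Finset.mem_range.2 (hfin a (by omega))))
    have hrow : ∀ {a b}, b < len t a → q a b = e k → i ≤ a := fun {a b} h h' => by
      refine hmin a (hfin a (by omega)) (le_antisymm (hmax a (Finset.mem_range.2
        (hfin a (by omega)))) ?_)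
      rw [← h']
      rcases (show b ≤ len t a - 1 by omega).lt_or_eq with h2 | h2
      · exact hq.row_le h2 (by omega)
      · simp [e, h2]
    have hipos := ht.len_pos hi
    have hcorner : len t (i + 1) < len t i := by
      refine (ht.len_succ_le i).lt_of_ne fun h => ?_
      have h1 : q i (len t i - 1) < q (i + 1) (len t i - 1) := hq.col_lt (by omega) (by omega)
      have h2 := hle (a := i + 1) (b := len t i - 1) (by omega)
      have h3 : q i (len t i - 1) = e k := hik
      omega
    obtain ⟨x, t', ht', rfl, rfl⟩ := exists_tableauInsert_eq ht hcorner
    set i := insRow x t' with hi_def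
    let q' : ℕ → ℕ → ℕ := fun a b => if a = i ∧ b = len t' i then 0 else q a b
    have hlen := len_tableauInsert x t'
    have hq' : IsFilling t' q' := by
      refine ⟨fun {a j₁ j₂} hj h => ?_, fun {i₁ i₂ j} hi h => ?_, fun {a b} h => ?_⟩
      · have h1 : ¬ (a = i ∧ j₁ = len t' i) := by rintro ⟨rfl, rfl⟩; omega
        have h2 : ¬ (a = i ∧ j₂ = len t' i) := by rintro ⟨rfl, rfl⟩; omega
        simp only [q', if_neg h1, if_neg h2]
        exact hq.row_le hj (by rw [hlen]; omega)
      · have h0 := ht'.len_antitone hi.le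
        have h1 : ¬ (i₁ = i ∧ j = len t' i) := by rintro ⟨rfl, rfl⟩; omega
        have h2 : ¬ (i₂ = i ∧ j = len t' i) := by rintro ⟨rfl, rfl⟩; omega
        simp only [q', if_neg h1, if_neg h2]
        exact hq.col_lt hi (by rw [hlen]; omega)
      · simp only [q']
        split_ifs with h1
        · rfl
        · refine hq.zeros ?_
          rw [hlen, ← hi_def]
          split_ifs with h2
          · have : b ≠ len t' i := fun h3 => h1 ⟨h2, h3⟩
            rw [h2] at h ⊢
            omega
          · exact h
    have hn' : t'.flatten.length = n := by
      have := (tableauInsert_flatten_perm x t').length_eq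
      rw [List.length_cons] at this
      omega
    obtain ⟨L, hL, rfl, hLq⟩ := ih ht' hq' hn'
    have hik' : q i (len (insTab L) i) = e k := by
      rw [← hik]
      simp [e, hlen, hi_def]
    refine ⟨(e k, x) :: L, ?_, rfl, ?_⟩
    · cases L with
      | nil => simp [LexSorted]
      | cons p L =>
        -- the label of `p` is a label of `q`
        have hcell : len (insTab L) (insRow p.2 (insTab L)) <
            len (insTab (p :: L)) (insRow p.2 (insTab L)) := by
          rw [insTab_cons, len_tableauInsert, if_pos rfl]; omega
        have hcell' := hcell.trans_le (show _ ≤ len (tableauInsert x (insTab (p :: L)))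
          (insRow p.2 (insTab L)) by rw [hlen]; omega)
        have hqp : q (insRow p.2 (insTab L)) (len (insTab L) (insRow p.2 (insTab L))) = p.1 := by
          have h1 := congrFun (congrFun hLq (insRow p.2 (insTab L)))
            (len (insTab L) (insRow p.2 (insTab L)))
          rw [recTab_cons_insRow] at h1
          simp only [q'] at h1
          rw [if_neg] at h1
          · exact h1.symm
          · rintro ⟨h2, h3⟩
            rw [← h2] at h3
            omega
        have hp : p.1 < e k ∨ p.1 = e k ∧ p.2 ≤ x := by
          have h1 := hle hcell'
          rw [hqp] at h1
          rcases h1.lt_or_eq with h1 | h1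
          · exact Or.inl h1
          · refine Or.inr ⟨h1, ?_⟩
            by_contra h2
            have h3 := insRow_lt_insRow_tableauInsert (not_le.1 h2) (isTab_insTab L)
            have h4 := hrow hcell' (hqp.trans h1)
            exact absurd h4 (not_le.2 h3)
        refine List.pairwise_cons.2 ⟨fun r hr => ?_, hL⟩
        rcases List.mem_cons.1 hr with rfl | hr
        · exact hp
        · have h1 := (List.pairwise_cons.1 hL).1 r hr
          simp only
          omega
    · funext a b
      rw [recTab, hLq]
      split_ifs with hc
      · obtain ⟨rfl, rfl⟩ := hc
        exact hik'.symm
      · simp only [q']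
        rw [if_neg]
        rintro ⟨rfl, rfl⟩
        exact hc ⟨rfl, rfl⟩

theorem sum_recTab {M : Type*} [AddCommMonoid M] (g : ℕ → M) (L : List (ℕ × ℕ))
    {C : Finset (ℕ × ℕ)} (hC : ∀ c, c ∈ C ↔ c.2 < len (insTab L) c.1) :
    ∑ c ∈ C, g (recTab L c.1 c.2) = (L.map fun p => g p.1).sum := by
  induction L generalizing C with
  | nil =>
    have : C = ∅ := by ext c; simp [hC, len]
    simp [this]
  | cons p L ih =>
    set c₀ : ℕ × ℕ := (insRow p.2 (insTab L), len (insTab L) (insRow p.2 (insTab L))) with hc₀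
    have hmem : c₀ ∈ C := by
      rw [hC, insTab_cons, len_tableauInsert, if_pos rfl]
      simp [hc₀]
    rw [← Finset.add_sum_erase C _ hmem, recTab_cons_insRow, List.map_cons, List.sum_cons,
      ← ih (C := C.erase c₀)]
    · congr 1
      refine Finset.sum_congr rfl fun c hc => ?_
      rw [recTab, if_neg]
      rintro ⟨h1, h2⟩
      refine (Finset.mem_erase.1 hc).1 (Prod.ext h1 ?_)
      rw [h2, h1]
    · intro c
      rw [Finset.mem_erase, hC, insTab_cons, len_tableauInsert]
      have : c = c₀ ↔ c.1 = insRow p.2 (insTab L) ∧ c.2 = len (insTab L) c.1 := by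
        rw [Prod.ext_iff]
        constructor
        · rintro ⟨h1, h2⟩
          exact ⟨h1, by rw [h2, h1]⟩
        · rintro ⟨h1, h2⟩
          exact ⟨h1, by rw [h2, h1]⟩
      rw [Ne, this]
      split_ifs with h
      · simp only [h, true_and]
        omega
      · simp [h]

/-! ### Monotone subsequences and Knuth equivalence

Words are written from right to left: the head of a list is the last letter. -/

section chainLen
variable (R : ℕ → ℕ → Prop) [DecidableRel R]

/-- The maximal length of a subsequence of the word such that each letter is `R`-related to the
next one, and the last letter to `x`. -/
def chainLen : List ℕ → ℕ → ℕ
  | [], _ => 0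
  | a :: u, x => if R a x then max (chainLen u x) (chainLen u a + 1) else chainLen u x

variable {R}

theorem chainLen_le_of_imp {x y : ℕ} (h : ∀ a, R a x → R a y) (u : List ℕ) :
    chainLen R u x ≤ chainLen R u y := by
  induction u with
  | nil => simp [chainLen]
  | cons a u ih =>
    have := h a
    simp only [chainLen]
    split_ifs <;> first | omega | tauto

theorem chainLen_append_congr {u v : List ℕ} (h : ∀ x, chainLen R u x = chainLen R v x)
    (w : List ℕ) (x : ℕ) : chainLen R (w ++ u) x = chainLen R (w ++ v) x := by
  induction w generalizing x with
  | nil => exact h x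
  | cons a w ih => simp only [List.cons_append, chainLen, ih]

end chainLen

/-- The length of the longest weakly increasing subsequence with letters at most `x`. -/
def inc : List ℕ → ℕ → ℕ := chainLen (· ≤ ·)

/-- The length of the longest strictly decreasing subsequence with letters larger than `x`. -/
def dec : List ℕ → ℕ → ℕ := chainLen (· > ·)

@[simp] theorem inc_nil (x : ℕ) : inc [] x = 0 := rfl

@[simp] theorem dec_nil (x : ℕ) : dec [] x = 0 := rfl

theorem inc_cons (a : ℕ) (u : List ℕ) (x : ℕ) :
    inc (a :: u) x = if a ≤ x then max (inc u x) (inc u a + 1) else inc u x := rfl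

theorem dec_cons (a : ℕ) (u : List ℕ) (x : ℕ) :
    dec (a :: u) x = if x < a then max (dec u x) (dec u a + 1) else dec u x := rfl

theorem inc_mono (u : List ℕ) {x y : ℕ} (h : x ≤ y) : inc u x ≤ inc u y :=
  chainLen_le_of_imp (fun _ ha => ha.trans h) u

theorem dec_anti (u : List ℕ) {x y : ℕ} (h : x ≤ y) : dec u y ≤ dec u x :=
  chainLen_le_of_imp (R := (· > ·)) (fun _ ha => lt_of_le_of_lt h ha) u

/-- Some letter ends both an increasing subsequence of length `r` and a decreasing one of
length `s`. -/
def HasPeak (r s : ℕ) : List ℕ → Prop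
  | [] => False
  | a :: u => HasPeak r s u ∨ (r ≤ inc u a + 1 ∧ s ≤ dec u a + 1)

/-- Two words that cannot be distinguished, as prefixes, by `inc`, `dec` and `HasPeak`. -/
structure PeakEquiv (r s : ℕ) (u v : List ℕ) : Prop where
  inc_eq : ∀ x, inc u x = inc v x
  dec_eq : ∀ x, dec u x = dec v x
  peak : HasPeak r s u ↔ HasPeak r s v

variable {r s : ℕ}

theorem PeakEquiv.refl (u : List ℕ) : PeakEquiv r s u u := ⟨fun _ => rfl, fun _ => rfl, Iff.rfl⟩

theorem PeakEquiv.trans {u v w : List ℕ} (h : PeakEquiv r s u v) (h' : PeakEquiv r s v w) :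
    PeakEquiv r s u w :=
  ⟨fun x => (h.1 x).trans (h'.1 x), fun x => (h.2 x).trans (h'.2 x), h.3.trans h'.3⟩

theorem PeakEquiv.symm {u v : List ℕ} (h : PeakEquiv r s u v) : PeakEquiv r s v u :=
  ⟨fun x => (h.1 x).symm, fun x => (h.2 x).symm, h.3.symm⟩

theorem PeakEquiv.append {u v : List ℕ} (h : PeakEquiv r s u v) (w : List ℕ) :
    PeakEquiv r s (w ++ u) (w ++ v) := by
  refine ⟨chainLen_append_congr h.1 w, chainLen_append_congr h.2 w, ?_⟩
  induction w with
  | nil => exact h.3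
  | cons a w ih =>
    have h1 : inc (w ++ u) a = inc (w ++ v) a := chainLen_append_congr h.1 w a
    have h2 : dec (w ++ u) a = dec (w ++ v) a := chainLen_append_congr h.2 w a
    simp only [List.cons_append, HasPeak, ih, h1, h2]

theorem peakEquiv_swap_of_lt_of_le {x y z : ℕ} (hxy : x < y) (hyz : y ≤ z) (u : List ℕ) :
    PeakEquiv r s (z :: x :: y :: u) (x :: z :: y :: u) := by
  have i1 := inc_mono u hxy.le
  have i2 := inc_mono u hyz
  have d1 := dec_anti u hxy.le
  have d2 := dec_anti u hyz
  refine ⟨fun w => ?_, fun w => ?_, ?_⟩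
  · have := inc_mono u (x := w) (y := x)
    have := inc_mono u (x := w) (y := y)
    have := inc_mono u (x := w) (y := z)
    simp only [inc_cons]
    split_ifs <;> omega
  · have := dec_anti u (x := w) (y := x)
    have := dec_anti u (x := w) (y := y)
    have := dec_anti u (x := w) (y := z)
    simp only [dec_cons]
    split_ifs <;> omega
  · by_cases hu : HasPeak r s u
    · simp [HasPeak, hu]
    · simp only [HasPeak, inc_cons, dec_cons, hu, false_or]
      split_ifs <;> omega

theorem peakEquiv_swap_of_le_of_lt {x y z : ℕ} (hxy : x ≤ y) (hyz : y < z) (u : List ℕ) :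
    PeakEquiv r s (y :: z :: x :: u) (y :: x :: z :: u) := by
  have i1 := inc_mono u hxy
  have i2 := inc_mono u hyz.le
  have d1 := dec_anti u hxy
  have d2 := dec_anti u hyz.le
  refine ⟨fun w => ?_, fun w => ?_, ?_⟩
  · have := inc_mono u (x := w) (y := x)
    have := inc_mono u (x := w) (y := y)
    have := inc_mono u (x := w) (y := z)
    simp only [inc_cons]
    split_ifs <;> omega
  · have := dec_anti u (x := w) (y := x)
    have := dec_anti u (x := w) (y := y)
    have := dec_anti u (x := w) (y := z)
    simp only [dec_cons]
    split_ifs <;> omega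
  · by_cases hu : HasPeak r s u
    · simp [HasPeak, hu]
    · simp only [HasPeak, inc_cons, dec_cons, hu, false_or]
      split_ifs <;> omega

/-- Moving a small letter to the left through a row. -/
theorem peakEquiv_move_left {x a : ℕ} (hx : x < a) {l : List ℕ}
    (hl : (a :: l).Pairwise (· ≤ ·)) (u : List ℕ) :
    PeakEquiv r s (x :: (l.reverse ++ a :: u)) (l.reverse ++ x :: a :: u) := by
  induction l generalizing a u with
  | nil => exact PeakEquiv.refl _
  | cons b l ih =>
    rw [List.pairwise_cons] at hl
    have hab := hl.1 b (by simp)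
    have h1 := ih (hx.trans_le hab) hl.2 (a :: u)
    simp only [List.reverse_cons, List.append_assoc, List.singleton_append]
    exact h1.trans ((peakEquiv_swap_of_lt_of_le hx hab u).symm |>.append _)

/-- Row insertion respects Knuth equivalence. -/
theorem peakEquiv_rowInsert {x y : ℕ} {l : List ℕ} (hl : l.Pairwise (· ≤ ·))
    (h : (rowInsert x l).2 = some y) (u : List ℕ) :
    PeakEquiv r s (x :: (l.reverse ++ u)) ((rowInsert x l).1.reverse ++ y :: u) := by
  induction l generalizing u with
  | nil => simp [rowInsert] at h
  | cons a l ih =>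
    by_cases hx : x < a
    · simp only [rowInsert, if_pos hx, Option.some.injEq] at h ⊢
      subst h
      simpa using peakEquiv_move_left hx hl u
    · rw [List.pairwise_cons] at hl
      simp only [rowInsert, if_neg hx] at h ⊢
      have h1 := ih hl.2 h (a :: u)
      obtain ⟨b, l', h2, h3⟩ := exists_rowInsert_eq_cons x l
      have hby := h3.trans_lt (lt_of_rowInsert_eq_some h)
      have hab : a ≤ b := by
        have : b ∈ (rowInsert x l).1 := by simp [h2]
        rcases mem_rowInsert this with rfl | h4
        · omega
        · exact hl.1 b h4
      rw [h2] at h1 ⊢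
      simp only [List.reverse_cons, List.append_assoc, List.cons_append, List.nil_append] at h1 ⊢
      exact h1.trans ((peakEquiv_swap_of_le_of_lt hab hby u).append _)

/-- The reading word of a tableau: the rows from bottom to top. -/
def readingWord (t : List (List ℕ)) : List ℕ := (t.map List.reverse).flatten

@[simp] theorem readingWord_nil : readingWord [] = [] := rfl

@[simp] theorem readingWord_cons (row : List ℕ) (rows : List (List ℕ)) :
    readingWord (row :: rows) = row.reverse ++ readingWord rows := rfl

theorem peakEquiv_tableauInsert {t : List (List ℕ)} (ht : IsTab t) (x : ℕ) :
    PeakEquiv r s (x :: readingWord t) (readingWord (tableauInsert x t)) := by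
  induction t generalizing x with
  | nil => exact PeakEquiv.refl _
  | cons row rows ih =>
    cases h : (rowInsert x row).2 with
    | none =>
      rw [tableauInsert_of_none h]
      simpa using PeakEquiv.refl _
    | some y =>
      rw [tableauInsert_of_some h]
      simp only [readingWord_cons]
      exact (peakEquiv_rowInsert ht.2.1 h _).trans ((ih ht.2.2.2 y).append _)

theorem peakEquiv_insTab (L : List (ℕ × ℕ)) :
    PeakEquiv r s (L.map Prod.snd) (readingWord (insTab L)) := by
  induction L with
  | nil => exact PeakEquiv.refl _
  | cons p L ih =>
    exact (ih.append [p.2]).trans (peakEquiv_tableauInsert (isTab_insTab L) p.2)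

/-! ### Peaks of reading words -/

/-- The number of letters of a row that are at most `x`. -/
abbrev cntLE (l : List ℕ) (x : ℕ) : ℕ := l.countP (· ≤ x)

theorem Dom.cntLE_le {l l' : List ℕ} (h : Dom l l') (x : ℕ) : cntLE l' x ≤ cntLE l x := by
  induction l generalizing l' with
  | nil => cases l' with
    | nil => simp
    | cons b l' => exact absurd h (dom_nil_cons _ _)
  | cons a l ih =>
    cases l' with
    | nil => simp
    | cons b l' =>
      have := ih h.2
      have := h.1
      simp only [cntLE, List.countP_cons, decide_eq_true_eq] at *
      split_ifs <;> omega

theorem Dom.cntLE_le_length {l m l' : List ℕ} {a : ℕ} (h : Dom (l ++ a :: m) l')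
    (hl' : l'.Pairwise (· ≤ ·)) : cntLE l' a ≤ l.length := by
  induction l generalizing l' with
  | nil =>
    cases l' with
    | nil => simp
    | cons b l' =>
      have h1 := h.1
      rw [List.pairwise_cons] at hl'
      simp only [List.length_nil, Nat.le_zero, List.countP_eq_zero, decide_eq_true_eq, not_le]
      intro c hc
      rcases List.mem_cons.1 hc with rfl | hc
      · exact h1
      · exact h1.trans_le (hl'.1 c hc)
  | cons e l ih =>
    cases l' with
    | nil => simp
    | cons b l' =>
      have := ih h.2 (List.pairwise_cons.1 hl').2
      simp only [cntLE, List.countP_cons, List.length_cons] at *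
      split_ifs <;> omega

theorem inc_reverse_append_le {row row' u : List ℕ} (hd : Dom row row')
    (hrow : row.Pairwise (· ≤ ·))
    (hrow' : row'.Pairwise (· ≤ ·)) (hu : ∀ x, inc u x ≤ cntLE row' x) (l m : List ℕ)
    (hl : l ++ m = row) (x : ℕ) :
    inc (l.reverse ++ u) x ≤ max (cntLE l x) (cntLE row' x) := by
  induction l using List.reverseRecOn generalizing m x with
  | nil => simpa using hu x
  | append_singleton l a ih =>
    have hl' : l ++ (a :: m) = row := by simpa using hl
    have h1 := ih (a :: m) hl' x
    have h2 := ih (a :: m) hl' a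
    have h3 := Dom.cntLE_le_length (hl' ▸ hd) hrow'
    have h4 : cntLE l a ≤ l.length := List.countP_le_length
    simp only [List.reverse_append, List.reverse_singleton, List.nil_append,
      List.cons_append, inc_cons]
    have h5 : a ≤ x → cntLE l x = l.length := fun hax => by
      rw [← hl', List.pairwise_append] at hrow
      exact List.countP_eq_length.2 fun b hb => by
        simpa using (hrow.2.2 b hb a (by simp)).trans hax
    have h6 : cntLE (l ++ [a]) x = cntLE l x + if a ≤ x then 1 else 0 := by
      simp [cntLE, List.countP_append, List.countP_cons]
    rw [h6]
    split_ifs with hax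
    · have := h5 hax
      omega
    · omega

theorem length_le_inc_reverse_append {l : List ℕ} (hl : l.Pairwise (· ≤ ·)) {x : ℕ}
    (hx : ∀ a ∈ l, a ≤ x) (u : List ℕ) : l.length ≤ inc (l.reverse ++ u) x := by
  induction l using List.reverseRecOn generalizing x with
  | nil => simp
  | append_singleton l a ih =>
    rw [List.pairwise_append] at hl
    have := ih hl.1 (x := a) fun b hb => hl.2.2 b hb a (by simp)
    have hax := hx a (by simp)
    simp only [List.reverse_append, List.reverse_singleton, List.nil_append,
      List.cons_append, inc_cons, if_pos hax, List.length_append, List.length_singleton]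
    omega

theorem inc_readingWord_le {t : List (List ℕ)} (ht : IsTab t) (x : ℕ) :
    inc (readingWord t) x ≤ cntLE (t.headD []) x := by
  induction t generalizing x with
  | nil => simp
  | cons row rows ih =>
    have h1 := inc_reverse_append_le ht.2.2.1 ht.2.1 ht.2.2.2.pairwise_headD (ih ht.2.2.2) row []
      (List.append_nil _) x
    have h2 := ht.2.2.1.cntLE_le x
    rw [readingWord_cons, List.headD_cons]
    omega

theorem hasPeak_reverse_append (row u : List ℕ) : HasPeak r s (row.reverse ++ u) ↔
    HasPeak r s u ∨ ∃ l a m, row = l ++ a :: m ∧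
      r ≤ inc (l.reverse ++ u) a + 1 ∧ s ≤ dec (l.reverse ++ u) a + 1 := by
  induction row using List.reverseRecOn with
  | nil => simp
  | append_singleton row b ih =>
    simp only [List.reverse_append, List.reverse_singleton, List.cons_append, List.nil_append,
      HasPeak, ih]
    constructor
    · rintro ((h | ⟨l, a, m, rfl, h⟩) | h)
      · exact Or.inl h
      · exact Or.inr ⟨l, a, m ++ [b], by simp, h⟩
      · exact Or.inr ⟨row, b, [], rfl, h⟩
    · rintro (h | ⟨l, a, m, h1, h⟩)
      · exact Or.inl (Or.inl h)
      · rcases List.eq_nil_or_concat m with rfl | ⟨m, b', rfl⟩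
        · rw [List.append_singleton_inj] at h1
          obtain ⟨rfl, rfl⟩ := h1
          exact Or.inr h
        · have h2 : row ++ [b] = (l ++ a :: m) ++ [b'] := by simpa using h1
          rw [List.append_singleton_inj] at h2
          exact Or.inl (Or.inr ⟨l, a, m, h2.1, h⟩)

theorem dec_append_of_le {w : List ℕ} {x : ℕ} (hw : ∀ b ∈ w, b ≤ x) (u : List ℕ) :
    dec (w ++ u) x = dec u x := by
  induction w with
  | nil => rfl
  | cons b w ih =>
    rw [List.cons_append, dec_cons, if_neg (not_lt.2 (hw b (by simp))),
      ih fun b hb => hw b (List.mem_cons_of_mem _ hb)]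

theorem succ_le_dec_reverse_append {row : List ℕ} (hrow : row.Pairwise (· ≤ ·)) (u : List ℕ)
    (k x : ℕ) : k + 1 ≤ dec (row.reverse ++ u) x ↔
      k + 1 ≤ dec u x ∨ ∃ a ∈ row, x < a ∧ k ≤ dec u a := by
  induction row using List.reverseRecOn with
  | nil => simp
  | append_singleton row b ih =>
    rw [List.pairwise_append] at hrow
    have h1 : dec (row.reverse ++ u) b = dec u b :=
      dec_append_of_le (fun a ha => hrow.2.2 a (List.mem_reverse.1 ha) b (by simp)) u
    have h2 : (∃ a ∈ row ++ [b], x < a ∧ k ≤ dec u a) ↔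
        (∃ a ∈ row, x < a ∧ k ≤ dec u a) ∨ (x < b ∧ k ≤ dec u b) := by
      simp [or_and_right, exists_or]
    simp only [List.reverse_append, List.reverse_singleton, List.cons_append, List.nil_append,
      dec_cons, h1, h2, ← or_assoc, ← ih hrow.1]
    split_ifs with hx
    · simp [hx]
    · simp [hx]

theorem exists_peak_in_row {row : List ℕ} {rows : List (List ℕ)} (ht : IsTab (row :: rows))
    (hr : 1 ≤ r) : (∃ l a m, row = l ++ a :: m ∧ r ≤ inc (l.reverse ++ readingWord rows) a + 1 ∧
        s ≤ dec (l.reverse ++ readingWord rows) a + 1) ↔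
      ∃ a, row[r - 1]? = some a ∧ s ≤ dec (readingWord rows) a + 1 := by
  obtain ⟨-, h2, h3, h4⟩ := ht
  have hdec : ∀ {l a m}, row = l ++ a :: m → (∀ b ∈ l, b ≤ a) ∧
      dec (l.reverse ++ readingWord rows) a = dec (readingWord rows) a := by
    rintro l a m rfl
    have h : ∀ b ∈ l, b ≤ a := fun b hb => (List.pairwise_append.1 h2).2.2 b hb a (by simp)
    exact ⟨h, dec_append_of_le (fun b hb => h b (List.mem_reverse.1 hb)) _⟩
  constructor
  · rintro ⟨l, a, m, hl, h5, h6⟩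
    rw [(hdec hl).2] at h6
    have h7 := inc_reverse_append_le h3 h2 h4.pairwise_headD (inc_readingWord_le h4) l (a :: m)
      hl.symm a
    have h8 := Dom.cntLE_le_length (hl ▸ h3) h4.pairwise_headD
    have h9 : cntLE l a ≤ l.length := List.countP_le_length
    have hlen : row.length = l.length + (m.length + 1) := by simp [hl]
    have hlt : r - 1 < row.length := by omega
    refine ⟨row[r - 1], List.getElem?_eq_getElem hlt, h6.trans (Nat.succ_le_succ (dec_anti _ ?_))⟩
    have ha : row[l.length]'(by omega) = a := by simp [hl]
    rcases (show r - 1 ≤ l.length by omega).lt_or_eq with h10 | h10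
    · exact (List.pairwise_iff_getElem.1 h2 _ _ hlt (by omega) h10).trans_eq ha
    · simp only [h10, ha, le_refl]
  · rintro ⟨a, ha, h5⟩
    obtain ⟨hlt, rfl⟩ := List.getElem?_eq_some_iff.1 ha
    have hl : row = row.take (r - 1) ++ row[r - 1] :: row.drop (r - 1 + 1) := by simp
    refine ⟨_, _, _, hl, ?_, by rwa [(hdec hl).2]⟩
    have h6 := length_le_inc_reverse_append (h2.sublist (List.take_sublist (r - 1) row)) (hdec hl).1
      (readingWord rows)
    rw [List.length_take] at h6
    omega

/-- A peak of the reading word of a tableau can be moved up to the first row. -/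
theorem hasPeak_readingWord {row : List ℕ} {rows : List (List ℕ)} (ht : IsTab (row :: rows))
    (hr : 1 ≤ r) : HasPeak r s (readingWord (row :: rows)) ↔
      ∃ a, row[r - 1]? = some a ∧ s ≤ dec (readingWord rows) a + 1 := by
  rw [readingWord_cons, hasPeak_reverse_append, exists_peak_in_row ht hr, or_iff_right_iff_imp]
  induction rows generalizing row with
  | nil => exact False.elim
  | cons row' rows ih =>
    intro h
    rw [readingWord_cons, hasPeak_reverse_append, exists_peak_in_row ht.2.2.2 hr] at h
    obtain ⟨a, ha, h5⟩ := h.elim (ih ht.2.2.2) id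
    obtain ⟨hlt', rfl⟩ := List.getElem?_eq_some_iff.1 ha
    obtain ⟨h6, h7⟩ := dom_iff.1 ht.2.2.1
    simp only [List.headD_cons] at h6 h7
    have hlt : r - 1 < row.length := by omega
    refine ⟨row[r - 1], List.getElem?_eq_getElem hlt, Nat.le_succ_of_le (h5.trans ?_)⟩
    rw [readingWord_cons, succ_le_dec_reverse_append ht.2.2.2.2.1]
    exact Or.inr ⟨_, List.getElem_mem hlt', h7 _ hlt hlt', le_rfl⟩

/-- The entry of a list of rows in row `i` and column `j`. -/
def ent (t : List (List ℕ)) (i j : ℕ) : ℕ := (t.getD i []).getD j 0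

theorem len_drop (t : List (List ℕ)) (i j : ℕ) : len (t.drop i) j = len t (i + j) := by
  simp [len, List.getD_eq_getElem?_getD, List.getElem?_drop]

theorem ent_drop (t : List (List ℕ)) (i j k : ℕ) : ent (t.drop i) j k = ent t (i + j) k := by
  simp [ent, List.getD_eq_getElem?_getD, List.getElem?_drop]

theorem IsTab.drop {t : List (List ℕ)} (ht : IsTab t) (i : ℕ) : IsTab (t.drop i) := by
  induction i generalizing t with
  | zero => simpa using ht
  | succ i ih =>
    cases t with
    | nil => simpa using ht
    | cons row rows => simpa using ih ht.2.2.2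

theorem succ_le_dec_readingWord {t : List (List ℕ)} (ht : IsTab t) (k x : ℕ) :
    k + 1 ≤ dec (readingWord t) x ↔ ∃ i j, j < len t i ∧ x < ent t i j ∧
      k ≤ dec (readingWord (t.drop (i + 1))) (ent t i j) := by
  induction t with
  | nil => simp [len]
  | cons row rows ih =>
    rw [readingWord_cons, succ_le_dec_reverse_append ht.2.1, ih ht.2.2.2]
    constructor
    · rintro (⟨i, j, h⟩ | ⟨a, ha, h⟩)
      · exact ⟨i + 1, j, by simpa [len, ent] using h⟩
      · obtain ⟨j, hj, rfl⟩ := List.mem_iff_getElem.1 ha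
        exact ⟨0, j, by simpa [len, ent, hj] using h⟩
    · rintro ⟨i, j, h⟩
      cases i with
      | zero =>
        have hj : j < row.length := by simpa [len] using h.1
        exact Or.inr ⟨row[j], List.getElem_mem hj, by simpa [len, ent, hj] using h⟩
      | succ i => exact Or.inl ⟨i, j, by simpa [len, ent] using h⟩

theorem strictMono_fin_cons {k : ℕ} {α β : Type*} [Preorder β] {g : α → β} {a : α} {c : Fin k → α}
    (hc : StrictMono fun m => g (c m)) (ha : ∀ m, g a < g (c m)) :
    StrictMono fun m => g ((Fin.cons a c : Fin (k + 1) → α) m) := by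
  intro m n hmn
  cases n using Fin.cases with
  | zero => exact absurd hmn (Fin.not_lt_zero _)
  | succ n =>
    cases m using Fin.cases with
    | zero => simpa using ha n
    | succ m => simpa using hc (Fin.succ_lt_succ_iff.1 hmn)

theorem le_dec_readingWord_drop {t : List (List ℕ)} (ht : IsTab t) (k i x : ℕ) :
    k ≤ dec (readingWord (t.drop i)) x ↔ ∃ c : Fin k → ℕ × ℕ,
      (∀ m, i ≤ (c m).1 ∧ (c m).2 < len t (c m).1 ∧ x < ent t (c m).1 (c m).2) ∧
      StrictMono (fun m => (c m).1) ∧ StrictMono (fun m => ent t (c m).1 (c m).2) := by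
  induction k generalizing i x with
  | zero =>
    exact iff_of_true (Nat.zero_le _) ⟨fun m => m.elim0, fun m => m.elim0, fun m => m.elim0,
      fun m => m.elim0⟩
  | succ k ih =>
    rw [succ_le_dec_readingWord (ht.drop i)]
    simp only [len_drop, ent_drop, List.drop_drop, ← add_assoc, ih]
    constructor
    · rintro ⟨i', j, h1, h2, c, h3, h4, h5⟩
      refine ⟨Fin.cons (i + i', j) c, fun m => ?_, ?_, ?_⟩
      · cases m using Fin.cases with
        | zero => exact ⟨Nat.le_add_right _ _, h1, h2⟩
        | succ m =>
          obtain ⟨h6, h7, h8⟩ := h3 m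
          simp only [Fin.cons_succ]
          exact ⟨by omega, h7, h2.trans h8⟩
      · exact strictMono_fin_cons (g := Prod.fst) h4 fun m => (h3 m).1
      · exact strictMono_fin_cons (g := fun p : ℕ × ℕ => ent t p.1 p.2) h5 fun m => (h3 m).2.2
    · rintro ⟨c, h1, h2, h3⟩
      obtain ⟨i', hi'⟩ := Nat.exists_eq_add_of_le (h1 0).1
      refine ⟨i', (c 0).2, hi' ▸ (h1 0).2.1, hi' ▸ (h1 0).2.2, fun m => c m.succ,
        fun m => ⟨?_, (h1 _).2.1, ?_⟩, fun m n h => h2 (Fin.succ_lt_succ_iff.2 h),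
        fun m n h => h3 (Fin.succ_lt_succ_iff.2 h)⟩
      · have : (c 0).1 < (c m.succ).1 := h2 (Fin.succ_pos m)
        simp only
        omega
      · rw [← hi']
        exact h3 (Fin.succ_pos m)

variable {μ : YoungDiagram}

/-! ### Ascending sequences and peaks -/

theorem SYT.one_le_entry (P : SYT μ) {i j : ℕ} (h : (i, j) ∈ μ) : 1 ≤ P.entry i j :=
  (Finset.mem_Icc.1 (P.bijOn.mapsTo (x := (i, j)) h)).1

theorem SYT.entry_le (P : SYT μ) {i j : ℕ} (h : (i, j) ∈ μ) : P.entry i j ≤ μ.card :=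
  (Finset.mem_Icc.1 (P.bijOn.mapsTo (x := (i, j)) h)).2

theorem SYT.entry_pos_iff (P : SYT μ) {i j : ℕ} : 0 < P.entry i j ↔ (i, j) ∈ μ :=
  ⟨fun h => by
    by_contra h'
    rw [P.zeros h'] at h
    exact h.false, P.one_le_entry⟩

/-- `t` is the list of the rows of the standard Young tableau `P`. -/
structure SYT.HasRows (P : SYT μ) (t : List (List ℕ)) : Prop where
  isTab : IsTab t
  mem_iff : ∀ i j, (i, j) ∈ μ ↔ j < len t i
  ent_eq : ∀ i j, ent t i j = P.entry i j

theorem len_eq_zero {t : List (List ℕ)} {i : ℕ} (h : t.length ≤ i) : len t i = 0 := by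
  rw [len, List.getD_eq_default _ _ h, List.length_nil]

theorem ent_mem_flatten {t : List (List ℕ)} {i j : ℕ} (h : j < len t i) :
    ent t i j ∈ t.flatten := by
  have hi : i < t.length := by
    by_contra hi
    rw [len_eq_zero (not_lt.1 hi)] at h
    exact Nat.not_lt_zero _ h
  have hj : j < t[i].length := by simpa [len, hi] using h
  refine List.mem_flatten.2 ⟨t[i], List.getElem_mem hi, ?_⟩
  simp [ent, hi, hj]

theorem exists_ent_of_mem_flatten {t : List (List ℕ)} {a : ℕ} (h : a ∈ t.flatten) :
    ∃ i j, j < len t i ∧ ent t i j = a := by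
  obtain ⟨row, hrow, ha⟩ := List.mem_flatten.1 h
  obtain ⟨i, hi, rfl⟩ := List.mem_iff_getElem.1 hrow
  obtain ⟨j, hj, rfl⟩ := List.mem_iff_getElem.1 ha
  exact ⟨i, j, by simpa [len, hi] using hj, by simp [ent, hi, hj]⟩

theorem ent_eq_zero {t : List (List ℕ)} {i j : ℕ} (h : len t i ≤ j) : ent t i j = 0 :=
  List.getD_eq_default _ _ h

theorem SYT.hasRows_of_ent_eq (P : SYT μ) {t : List (List ℕ)} (ht : IsTab t)
    (hpos : ∀ a ∈ t.flatten, 0 < a) (h : ∀ i j, ent t i j = P.entry i j) : P.HasRows t := by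
  refine ⟨ht, fun i j => ?_, h⟩
  rw [← P.entry_pos_iff, ← h]
  refine ⟨fun h' => ?_, fun h' => hpos _ (ent_mem_flatten h')⟩
  by_contra h''
  rw [ent_eq_zero (not_lt.1 h'')] at h'
  exact h'.false

theorem SYT.hasAscendingSequence_iff {P : SYT μ} {t : List (List ℕ)} (h : P.HasRows t)
    (hr : 1 ≤ r) (hs : 1 ≤ s) :
    P.HasAscendingSequence r s ↔ HasPeak r s (readingWord t) := by
  obtain ⟨k, rfl⟩ := Nat.exists_eq_add_of_le' hs
  cases t with
  | nil =>
    refine iff_of_false ?_ id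
    rintro ⟨c, hc, -⟩
    have := (h.mem_iff _ _).1 (hc 0)
    simp [len] at this
  | cons row rows =>
    have hdrop := le_dec_readingWord_drop h.isTab k 1
    rw [hasPeak_readingWord h.isTab hr]
    simp only [List.drop_succ_cons, List.drop_zero] at hdrop
    simp only [Nat.add_le_add_iff_right, hdrop, h.ent_eq, ← h.mem_iff]
    constructor
    · rintro ⟨c, h1, h2, h3, h4⟩
      have h0 := h2 0 rfl
      have hlt : r - 1 < row.length := by simpa [h0, h.mem_iff, len] using h1 0
      have he : P.entry 0 (r - 1) = row[r - 1] := by simp [← h.ent_eq, ent, hlt]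
      refine ⟨row[r - 1], List.getElem?_eq_getElem hlt, fun m => c m.succ,
        fun m => ⟨?_, h1 _, ?_⟩, fun m n hmn => h3 (Fin.succ_lt_succ_iff.2 hmn),
        fun m n hmn => h4 (Fin.succ_lt_succ_iff.2 hmn)⟩
      · have := h3 (Fin.succ_pos m)
        simp only at this ⊢
        omega
      · have := h4 (Fin.succ_pos m)
        simp only [h0] at this
        rwa [← he]
    · rintro ⟨a, ha, c, h1, h2, h3⟩
      obtain ⟨hlt, rfl⟩ := List.getElem?_eq_some_iff.1 ha
      have he : P.entry 0 (r - 1) = row[r - 1] := by simp [← h.ent_eq, ent, hlt]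
      refine ⟨Fin.cons (0, r - 1) c, fun m => ?_, fun m hm => ?_,
        strictMono_fin_cons (g := Prod.fst) h2 fun m => (h1 m).1,
        strictMono_fin_cons (g := fun p : ℕ × ℕ => P.entry p.1 p.2) h3 fun m => ?_⟩
      · cases m using Fin.cases with
        | zero => simpa [h.mem_iff, len] using hlt
        | succ m => exact (h1 m).2.1
      · obtain rfl : m = 0 := Fin.ext hm
        rfl
      · simp only [he]
        exact (h1 m).2.2

/-! ### From standard tableaux to lists of rows and back -/

theorem isTab_of_forall {t : List (List ℕ)} (h : ∀ i (hi : i < t.length), t[i] ≠ [] ∧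
    t[i].Pairwise (· ≤ ·) ∧ Dom t[i] (t.getD (i + 1) [])) : IsTab t := by
  induction t with
  | nil => trivial
  | cons row rows ih =>
    obtain ⟨h1, h2, h3⟩ := h 0 (by simp)
    refine ⟨h1, h2, ?_, ih fun i hi => ?_⟩
    · cases rows with
      | nil => exact dom_nil _
      | cons row' rows => simpa using h3
    · have h4 : i + 1 < (row :: rows).length := by simpa using hi
      exact h (i + 1) h4

/-- The list of rows of a standard Young tableau. -/
def SYT.rows (P : SYT μ) : List (List ℕ) :=
  (List.range (μ.colLen 0)).map fun i => (List.range (μ.rowLen i)).map (P.entry i)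

theorem SYT.getD_rows (P : SYT μ) (i : ℕ) :
    P.rows.getD i [] = (List.range (μ.rowLen i)).map (P.entry i) := by
  by_cases hi : i < μ.colLen 0
  · simp [SYT.rows, hi]
  · have : μ.rowLen i = 0 := by
      rw [← YoungDiagram.mem_iff_lt_colLen, YoungDiagram.mem_iff_lt_rowLen] at hi
      omega
    simp [SYT.rows, hi, this]

theorem SYT.hasRows_rows (P : SYT μ) : P.HasRows P.rows := by
  refine ⟨isTab_of_forall fun i hi => ?_, fun i j => ?_, fun i j => ?_⟩
  · have hi' : i < μ.colLen 0 := by simpa [SYT.rows] using hi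
    rw [← List.getD_eq_getElem _ [] hi, P.getD_rows, P.getD_rows]
    refine ⟨?_, ?_, ?_⟩
    · rw [← YoungDiagram.mem_iff_lt_colLen, YoungDiagram.mem_iff_lt_rowLen] at hi'
      simp [hi'.ne']
    · rw [List.pairwise_iff_getElem]
      intro j₁ j₂ h1 h2 h3
      simp only [List.length_map, List.length_range] at h1 h2
      simpa using (P.row_strict h3 (YoungDiagram.mem_iff_lt_rowLen.2 h2)).le
    · rw [dom_iff]
      refine ⟨by simpa using μ.rowLen_anti i (i + 1) (by omega), fun j h1 h2 => ?_⟩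
      simp only [List.length_map, List.length_range] at h2
      simpa using P.col_strict (Nat.lt_succ_self i) (YoungDiagram.mem_iff_lt_rowLen.2 h2)
  · rw [len, P.getD_rows, YoungDiagram.mem_iff_lt_rowLen]
    simp
  · rw [ent, P.getD_rows]
    by_cases hj : j < μ.rowLen i
    · simp [hj]
    · rw [P.zeros (mt YoungDiagram.mem_iff_lt_rowLen.1 hj)]
      simp [hj]

theorem SYT.HasRows.unique {P : SYT μ} {t t' : List (List ℕ)} (h : P.HasRows t)
    (h' : P.HasRows t') : t = t' := by
  have hlen : ∀ i, len t i = len t' i := fun i => by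
    have h1 := fun j => (h.mem_iff i j).symm.trans (h'.mem_iff i j)
    have h2 := h1 (len t i)
    have h3 := h1 (len t' i)
    omega
  have hlt : ∀ {t : List (List ℕ)}, IsTab t → ∀ i, i < t.length ↔ 0 < len t i := fun {t} ht i =>
    ⟨ht.len_pos, fun hi => by
      by_contra hi'
      exact hi.ne' (len_eq_zero (not_lt.1 hi'))⟩
  refine List.ext_getElem ?_ fun i hi hi' => List.ext_getElem ?_ fun j hj hj' => ?_
  · have h1 : ∀ i, i < t.length ↔ i < t'.length := fun i => by
      rw [hlt h.isTab, hlt h'.isTab, hlen]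
    have h2 := h1 t.length
    have h3 := h1 t'.length
    omega
  · simpa [len, hi, hi'] using hlen i
  · simpa [ent, hi, hi', hj, hj'] using (h.ent_eq i j).trans (h'.ent_eq i j).symm

theorem IsTab.ent_lt_of_lt {t : List (List ℕ)} (ht : IsTab t) {i₁ i₂ j : ℕ} (hi : i₁ < i₂)
    (hj : j < len t i₂) : ent t i₁ j < ent t i₂ j := by
  induction t generalizing i₁ i₂ with
  | nil => simp [len] at hj
  | cons row rows ih =>
    obtain ⟨i₂, rfl⟩ := Nat.exists_eq_add_of_lt (Nat.zero_lt_of_lt hi)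
    rw [zero_add] at *
    have hj' : j < len rows i₂ := by simpa [len] using hj
    cases i₁ with
    | succ i₁ => simpa [ent] using ih ht.2.2.2 (i₁ := i₁) (i₂ := i₂) (by omega) hj'
    | zero =>
      have hj0 := hj'.trans_le (ht.2.2.2.len_antitone (Nat.zero_le i₂))
      have h1 : ent (row :: rows) 0 j < ent rows 0 j := by
        obtain ⟨h2, h3⟩ := dom_iff.1 ht.2.2.1
        cases rows with
        | nil => simp [len] at hj'
        | cons row' rows =>
          have hj1 : j < row'.length := by simpa [len] using hj0
          have hj2 : j < row.length := hj1.trans_le h2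
          simpa [ent, hj1, hj2] using h3 j hj2 hj1
      have h2 : ent (row :: rows) (i₂ + 1) j = ent rows i₂ j := by simp [ent]
      rw [h2]
      rcases Nat.eq_zero_or_pos i₂ with rfl | hi₂
      · exact h1
      · exact h1.trans (ih ht.2.2.2 hi₂ hj')

theorem ent_lt_of_nodup {t : List (List ℕ)} (ht : IsTab t) (hnd : t.flatten.Nodup) {i j₁ j₂ : ℕ}
    (hj : j₁ < j₂) (h : j₂ < len t i) : ent t i j₁ < ent t i j₂ := by
  induction t generalizing i with
  | nil => simp [len] at h
  | cons row rows ih =>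
    rw [List.flatten_cons] at hnd
    cases i with
    | zero =>
      have h2 : j₂ < row.length := by simpa [len] using h
      have h1 := hj.trans h2
      have h3 := List.pairwise_iff_getElem.1 ht.2.1 _ _ h1 h2 hj
      have h4 : row[j₁] ≠ row[j₂] := fun e =>
        hj.ne ((List.Nodup.getElem_inj_iff hnd.of_append_left).1 e)
      simpa [ent, h1, h2] using lt_of_le_of_ne h3 h4
    | succ i =>
      simpa [ent] using ih ht.2.2.2 hnd.of_append_right (i := i) (by simpa [len] using h)

/-- The tableau of a word whose letters are `1, …, n` is standard. -/
theorem exists_hasRows_insTab {L : List (ℕ × ℕ)}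
    (hL : (L.map Prod.snd).Perm (List.range' 1 L.length))
    (hμ : ∀ i j, (i, j) ∈ μ ↔ j < len (insTab L) i) : ∃ P : SYT μ, P.HasRows (insTab L) := by
  have ht := isTab_insTab L
  have hp := (flatten_insTab_perm L).trans hL
  have hcard : μ.card = L.length := by
    have := sum_recTab (fun _ => 1) L (C := μ.cells) fun c => hμ c.1 c.2
    simpa using this
  have hmaps : Set.MapsTo (fun c : ℕ × ℕ => ent (insTab L) c.1 c.2) (μ.cells : Set (ℕ × ℕ))
      (Finset.Icc 1 μ.card : Set ℕ) := by
    rintro ⟨i, j⟩ hc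
    have := hp.subset (ent_mem_flatten ((hμ i j).1 hc))
    rw [List.mem_range'_1] at this
    simp only [Finset.coe_Icc, Set.mem_Icc]
    omega
  have hsurj : Set.SurjOn (fun c : ℕ × ℕ => ent (insTab L) c.1 c.2) (μ.cells : Set (ℕ × ℕ))
      (Finset.Icc 1 μ.card : Set ℕ) := by
    intro a ha
    simp only [Finset.coe_Icc, Set.mem_Icc] at ha
    obtain ⟨i, j, hj, rfl⟩ := exists_ent_of_mem_flatten
      (hp.symm.subset (a := a) (List.mem_range'_1.2 (by omega)))
    exact ⟨(i, j), (hμ i j).2 hj, rfl⟩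
  refine ⟨⟨ent (insTab L), fun {i j₁ j₂} hj h => ent_lt_of_nodup ht ?_ hj ((hμ _ _).1 h),
    fun {i₁ i₂ j} hi h => ht.ent_lt_of_lt hi ((hμ _ _).1 h),
    ⟨hmaps, Finset.injOn_of_surjOn_of_card_le _ hmaps hsurj (by simp), hsurj⟩,
    fun {i j} h => ent_eq_zero (by simpa [hμ] using h)⟩, ht, hμ, fun _ _ => rfl⟩
  exact hp.nodup_iff.2 List.nodup_range'

variable {n : ℕ}

/-! ### The biword of a labelled permutation -/

/-- The biword with letters `σ 0 + 1, …, σ (n - 1) + 1` and labels `f 0, …, f (n - 1)`. -/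
def biword (f : Fin n → ℕ) (σ : Equiv.Perm (Fin n)) : List (ℕ × ℕ) :=
  (List.ofFn fun i => (f i, (σ i : ℕ) + 1)).reverse

theorem map_snd_biword (f : Fin n → ℕ) (σ : Equiv.Perm (Fin n)) :
    (biword f σ).map Prod.snd = (oneLine σ).reverse := by
  simp [biword, oneLine, List.map_ofFn, Function.comp_def]

theorem insTab_biword (f : Fin n → ℕ) (σ : Equiv.Perm (Fin n)) :
    insTab (biword f σ) = insertionTableau σ := by
  have h : ∀ L, insTab L = (L.map Prod.snd).foldr tableauInsert [] := fun L => by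
    rw [List.foldr_map]
    rfl
  rw [h, map_snd_biword, List.foldr_reverse]
  rfl

theorem oneLine_perm (σ : Equiv.Perm (Fin n)) : (oneLine σ).Perm (List.range' 1 n) := by
  refine (List.perm_ext_iff_of_nodup ?_ List.nodup_range').2 fun a => ?_
  · exact List.nodup_ofFn.2 fun i j h => σ.injective (Fin.ext (by simpa using h))
  · rw [List.mem_range'_1, oneLine, List.mem_ofFn]
    constructor
    · rintro ⟨i, rfl⟩
      have := (σ i).isLt
      omega
    · rintro ⟨h1, h2⟩
      exact ⟨σ.symm ⟨a - 1, by omega⟩, by simp; omega⟩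

theorem map_snd_biword_perm (f : Fin n → ℕ) (σ : Equiv.Perm (Fin n)) :
    ((biword f σ).map Prod.snd).Perm (List.range' 1 n) := by
  rw [map_snd_biword]
  exact (List.reverse_perm _).trans (oneLine_perm σ)

@[simp] theorem length_biword (f : Fin n → ℕ) (σ : Equiv.Perm (Fin n)) :
    (biword f σ).length = n := by
  simp [biword]

theorem isTab_insertionTableau (σ : Equiv.Perm (Fin n)) : IsTab (insertionTableau σ) :=
  insTab_biword 0 σ ▸ isTab_insTab _

theorem flatten_insertionTableau_perm (σ : Equiv.Perm (Fin n)) :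
    (insertionTableau σ).flatten.Perm (List.range' 1 n) :=
  insTab_biword 0 σ ▸ (flatten_insTab_perm _).trans (map_snd_biword_perm 0 σ)

theorem hasRows_insertionTableau_iff {P : SYT μ} {σ : Equiv.Perm (Fin n)} :
    P.HasRows (insertionTableau σ) ↔ ∀ i j, ent (insertionTableau σ) i j = P.entry i j :=
  ⟨fun h => h.ent_eq, P.hasRows_of_ent_eq (isTab_insertionTableau σ) fun a ha => by
    have := (flatten_insertionTableau_perm σ).subset ha
    rw [List.mem_range'_1] at this
    omega⟩

theorem IsTab.sortedGE_lengths {t : List (List ℕ)} (ht : IsTab t) :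
    (t.map List.length).SortedGE := by
  rw [List.sortedGE_iff_pairwise, List.pairwise_iff_getElem]
  intro i j hi hj hij
  rw [List.length_map] at hi hj
  simpa [len, hi, hj] using ht.len_antitone hij.le

theorem mem_ofRowLens_lengths {t : List (List ℕ)} (ht : IsTab t) (i j : ℕ) :
    (i, j) ∈ YoungDiagram.ofRowLens (t.map List.length) ht.sortedGE_lengths ↔ j < len t i := by
  rw [YoungDiagram.mem_ofRowLens]
  constructor
  · rintro ⟨hi, hj⟩
    simp only [List.length_map] at hi
    simpa [len, hi] using hj
  · intro h
    have hi : i < t.length := by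
      by_contra hi
      rw [len_eq_zero (not_lt.1 hi)] at h
      exact Nat.not_lt_zero _ h
    exact ⟨by simpa using hi, by simpa [len, hi] using h⟩

theorem exists_hasRows (σ : Equiv.Perm (Fin n))
    (hμ : ∀ i j, (i, j) ∈ μ ↔ j < len (insertionTableau σ) i) :
    ∃ P : SYT μ, P.HasRows (insertionTableau σ) := by
  rw [← insTab_biword 0] at hμ ⊢
  exact exists_hasRows_insTab (by simpa using map_snd_biword_perm 0 σ) hμ

theorem card_eq_of_hasRows {P : SYT μ} {σ : Equiv.Perm (Fin n)}
    (h : P.HasRows (insertionTableau σ)) : μ.card = n := by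
  rw [← insTab_biword 0] at h
  have h1 := sum_recTab (fun _ => 1) (biword 0 σ) (C := μ.cells) fun c => h.mem_iff c.1 c.2
  rw [Finset.sum_const, smul_eq_mul, mul_one] at h1
  rw [YoungDiagram.card, h1]
  simp

/-- A permutation has a peak if and only if its insertion tableau has an ascending sequence. -/
theorem hasAscendingSequence_iff_hasPeak {P : SYT μ} {σ : Equiv.Perm (Fin n)}
    (h : P.HasRows (insertionTableau σ)) (hr : 1 ≤ r) (hs : 1 ≤ s) :
    P.HasAscendingSequence r s ↔ HasPeak r s (oneLine σ).reverse := by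
  rw [SYT.hasAscendingSequence_iff h hr hs, ← insTab_biword 0, ← map_snd_biword 0]
  exact (peakEquiv_insTab _).peak.symm

/-! ### Peaks of permutations -/

/-- The word `w (n - 1), …, w 0`, whose head is its last letter. -/
def prefixWord (w : ℕ → ℕ) : ℕ → List ℕ
  | 0 => []
  | i + 1 => w i :: prefixWord w i

theorem le_chainLen_prefixWord {R : ℕ → ℕ → Prop} [DecidableRel R] (hR : ∀ {a b c}, R a b → R b c → R a c)
    {w : ℕ → ℕ} {k i x : ℕ} :
    k ≤ chainLen R (prefixWord w i) x ↔ ∃ A : Finset ℕ, A.card = k ∧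
      (∀ a ∈ A, a < i ∧ R (w a) x) ∧ ∀ a ∈ A, ∀ b ∈ A, a < b → R (w a) (w b) := by
  induction i generalizing k x with
  | zero =>
    simp only [prefixWord, chainLen]
    constructor
    · intro h
      exact ⟨∅, by simp; omega, by simp, by simp⟩
    · rintro ⟨A, rfl, hA, -⟩
      rw [Nat.le_zero, Finset.card_eq_zero]
      exact Finset.eq_empty_of_forall_notMem fun a ha => Nat.not_lt_zero _ (hA a ha).1
  | succ i ih =>
    simp only [prefixWord, chainLen]
    constructor
    · intro h
      by_cases h1 : k ≤ chainLen R (prefixWord w i) x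
      · obtain ⟨A, h2, h3, h4⟩ := ih.1 h1
        exact ⟨A, h2, fun a ha => ⟨(h3 a ha).1.trans (Nat.lt_succ_self i), (h3 a ha).2⟩, h4⟩
      · split_ifs at h with hx
        · obtain ⟨k, rfl⟩ := Nat.exists_eq_succ_of_ne_zero (show k ≠ 0 by omega)
          obtain ⟨A, h2, h3, h4⟩ := (ih (k := k) (x := w i)).1 (by omega)
          refine ⟨insert i A, ?_, ?_, ?_⟩
          · rw [Finset.card_insert_of_notMem fun hi => (h3 i hi).1.false, h2]
          · intro a ha
            rcases Finset.mem_insert.1 ha with rfl | ha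
            · exact ⟨Nat.lt_succ_self _, hx⟩
            · exact ⟨(h3 a ha).1.trans (Nat.lt_succ_self i), hR (h3 a ha).2 hx⟩
          · intro a ha b hb hab
            rcases Finset.mem_insert.1 ha with ha' | ha' <;>
              rcases Finset.mem_insert.1 hb with hb' | hb'
            · omega
            · exact absurd (h3 b hb').1 (by omega)
            · exact hb' ▸ (h3 a ha').2
            · exact h4 a ha' b hb' hab
        · exact absurd h h1
    · rintro ⟨A, rfl, h3, h4⟩
      by_cases hi : i ∈ A
      · rw [if_pos (h3 i hi).2]
        have h5 := (ih (k := (A.erase i).card) (x := w i)).2 ⟨A.erase i, rfl, fun a ha => ?_,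
          fun a ha b hb => h4 a (Finset.mem_of_mem_erase ha) b (Finset.mem_of_mem_erase hb)⟩
        · have := Finset.card_erase_add_one hi
          omega
        · rw [Finset.mem_erase] at ha
          have h6 : a < i := by
            have := (h3 a ha.2).1
            omega
          exact ⟨h6, h4 a ha.2 i hi h6⟩
      · have h5 := (ih (k := A.card) (x := x)).2 ⟨A, rfl, fun a ha => ⟨?_, (h3 a ha).2⟩, h4⟩
        · split_ifs <;> omega
        · have h6 : a ≠ i := fun e => hi (e ▸ ha)
          have := (h3 a ha).1
          omega

theorem hasPeak_prefixWord {w : ℕ → ℕ} : HasPeak r s (prefixWord w n) ↔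
    ∃ i < n, r ≤ inc (prefixWord w i) (w i) + 1 ∧ s ≤ dec (prefixWord w i) (w i) + 1 := by
  induction n with
  | zero => simp [prefixWord, HasPeak]
  | succ n ih =>
    simp only [prefixWord, HasPeak, ih, Nat.lt_succ_iff_lt_or_eq, or_and_right, exists_or,
      exists_eq_left]

/-- Some value of `σ` ends both an increasing subsequence of length `r` and a decreasing one of
length `s`. -/
def PermPeak (r s : ℕ) (σ : Equiv.Perm (Fin n)) : Prop :=
  ∃ i : Fin n, ∃ A B : Finset (Fin n), A.card + 1 = r ∧ B.card + 1 = s ∧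
    (∀ a ∈ A, a < i ∧ σ a < σ i) ∧ (∀ b ∈ B, b < i ∧ σ i < σ b) ∧
    (∀ a ∈ A, ∀ b ∈ A, a < b → σ a < σ b) ∧ ∀ a ∈ B, ∀ b ∈ B, a < b → σ b < σ a

/-- The one-line notation of a permutation, extended by `0`. -/
def valueAt (σ : Equiv.Perm (Fin n)) (j : ℕ) : ℕ := if h : j < n then (σ ⟨j, h⟩ : ℕ) + 1 else 0

theorem valueAt_coe (σ : Equiv.Perm (Fin n)) (j : Fin n) : valueAt σ j = (σ j : ℕ) + 1 := by
  simp [valueAt]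

theorem reverse_oneLine (σ : Equiv.Perm (Fin n)) :
    (oneLine σ).reverse = prefixWord (valueAt σ) n := by
  have h : ∀ w m, prefixWord w m = ((List.range m).map w).reverse := fun w m => by
    induction m with
    | zero => rfl
    | succ m ih => rw [prefixWord, ih, List.range_succ]; simp
  rw [h, oneLine]
  congr 1
  refine List.ext_getElem (by simp) fun i h1 h2 => ?_
  have : i < n := by simpa using h1
  simp [valueAt, this]

theorem exists_finset_fin {p : Finset ℕ → Prop} (hp : ∀ A, p A → ∀ a ∈ A, a < n) :
    (∃ A, p A) ↔ ∃ A : Finset (Fin n), p (A.map Fin.valEmbedding) := by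
  constructor
  · rintro ⟨A, hA⟩
    refine ⟨A.attachFin (hp A hA), ?_⟩
    convert hA
    ext a
    simp only [Finset.mem_map, Finset.mem_attachFin, Fin.valEmbedding_apply]
    exact ⟨fun ⟨b, h1, h2⟩ => h2 ▸ h1, fun h => ⟨⟨a, hp A hA a h⟩, h, rfl⟩⟩
  · rintro ⟨A, hA⟩
    exact ⟨_, hA⟩

theorem hasPeak_iff_permPeak (σ : Equiv.Perm (Fin n)) (hr : 1 ≤ r) (hs : 1 ≤ s) :
    HasPeak r s (oneLine σ).reverse ↔ PermPeak r s σ := by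
  obtain ⟨k, rfl⟩ := Nat.exists_eq_add_of_le' hr
  obtain ⟨l, rfl⟩ := Nat.exists_eq_add_of_le' hs
  rw [reverse_oneLine, hasPeak_prefixWord]
  simp only [Nat.add_le_add_iff_right]
  have key : ∀ i : Fin n, (k ≤ inc (prefixWord (valueAt σ) i) (valueAt σ i) ↔
      ∃ A : Finset (Fin n), A.card = k ∧ (∀ a ∈ A, a < i ∧ σ a < σ i) ∧
        ∀ a ∈ A, ∀ b ∈ A, a < b → σ a < σ b) ∧
      (l ≤ dec (prefixWord (valueAt σ) i) (valueAt σ i) ↔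
      ∃ A : Finset (Fin n), A.card = l ∧ (∀ a ∈ A, a < i ∧ σ i < σ a) ∧
        ∀ a ∈ A, ∀ b ∈ A, a < b → σ b < σ a) := by
    intro i
    have hle : ∀ {a b : Fin n}, a < b → (σ a ≤ σ b ↔ σ a < σ b) := fun hab =>
      ⟨fun h => h.lt_of_ne (σ.injective.ne hab.ne), le_of_lt⟩
    constructor
    · unfold inc
      rw [le_chainLen_prefixWord (R := (· ≤ ·)) le_trans, exists_finset_fin (n := n)]
      · refine exists_congr fun A => ?_
        simp only [Finset.card_map, Finset.forall_mem_map, Fin.valEmbedding_apply, valueAt_coe,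
          Nat.add_le_add_iff_right, Fin.val_fin_le, Fin.val_fin_lt]
        refine and_congr_right fun _ => and_congr ?_ ?_
        · exact forall₂_congr fun a _ => and_congr_right hle
        · exact forall₅_congr fun a _ b _ h => hle h
      · exact fun A hA a ha => (hA.2.1 a ha).1.trans i.isLt
    · unfold dec
      rw [le_chainLen_prefixWord (R := (· > ·)) gt_trans, exists_finset_fin (n := n)]
      · refine exists_congr fun A => ?_
        simp only [Finset.card_map, Finset.forall_mem_map, Fin.valEmbedding_apply, valueAt_coe,
          gt_iff_lt, Nat.add_lt_add_iff_right, Fin.val_fin_lt]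
      · exact fun A hA a ha => (hA.2.1 a ha).1.trans i.isLt
  constructor
  · rintro ⟨i, hi, h1, h2⟩
    obtain ⟨A, rfl, hA1, hA2⟩ := (key ⟨i, hi⟩).1.1 h1
    obtain ⟨B, rfl, hB1, hB2⟩ := (key ⟨i, hi⟩).2.1 h2
    exact ⟨⟨i, hi⟩, A, B, rfl, rfl, hA1, hB1, hA2, hB2⟩
  · rintro ⟨i, A, B, hA, hB, hA1, hB1, hA2, hB2⟩
    exact ⟨i, i.isLt, (key i).1.2 ⟨A, by omega, hA1, hA2⟩, (key i).2.2 ⟨B, by omega, hB1, hB2⟩⟩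

theorem PermPeak.of_containsPattern {k : ℕ} {σ : Equiv.Perm (Fin n)} {π : Equiv.Perm (Fin k)}
    (h : PermPeak r s π) (hc : ContainsPattern σ π) : PermPeak r s σ := by
  obtain ⟨f, hf, hfσ⟩ := hc
  obtain ⟨i, A, B, hA, hB, hA1, hB1, hA2, hB2⟩ := h
  let e : Fin k ↪ Fin n := ⟨f, hf.injective⟩
  refine ⟨f i, A.map e, B.map e, by simpa, by simpa, ?_, ?_, ?_, ?_⟩ <;>
    simp only [Finset.forall_mem_map]
  · exact fun a ha => ⟨hf (hA1 a ha).1, (hfσ _ _).2 (hA1 a ha).2⟩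
  · exact fun a ha => ⟨hf (hB1 a ha).1, (hfσ _ _).2 (hB1 a ha).2⟩
  · exact fun a ha b hb hab => (hfσ _ _).2 (hA2 a ha b hb (hf.lt_iff_lt.1 hab))
  · exact fun a ha b hb hab => (hfσ _ _).2 (hB2 a ha b hb (hf.lt_iff_lt.1 hab))

/-- Every injective word has a standardization. -/
theorem exists_standardization {k : ℕ} {g : Fin k → Fin n} (hg : Function.Injective g) :
    ∃ π : Equiv.Perm (Fin k), ∀ a b, g a < g b ↔ π a < π b := by
  refine ⟨(Tuple.sort g)⁻¹, fun a b => ?_⟩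
  have h : StrictMono (g ∘ Tuple.sort g) :=
    (Tuple.monotone_sort g).strictMono_of_injective (hg.comp (Tuple.sort g).injective)
  rw [← h.lt_iff_lt]
  simp

theorem PermPeak.exists_containsPattern {k : ℕ} {σ : Equiv.Perm (Fin n)} (h : PermPeak r s σ)
    (hk : k + 1 = r + s) : ∃ π : Equiv.Perm (Fin k), ContainsPattern σ π ∧ PermPeak r s π := by
  obtain ⟨i, A, B, hA, hB, hA1, hB1, hA2, hB2⟩ := h
  have hiA : i ∉ A := fun h => (hA1 i h).1.false
  have hiB : i ∉ B := fun h => (hB1 i h).1.false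
  have hAB : Disjoint A B := Finset.disjoint_left.2 fun a ha hb =>
    ((hA1 a ha).2.trans (hB1 a hb).2).false
  set S := insert i (A ∪ B) with hS
  have hcard : S.card = k := by
    rw [hS, Finset.card_insert_of_notMem (by simp [hiA, hiB]), Finset.card_union_of_disjoint hAB]
    omega
  let f := S.orderEmbOfFin hcard
  obtain ⟨π, hπ⟩ := exists_standardization (g := fun a => σ (f a))
    (σ.injective.comp f.injective)
  have hrange : ∀ a ∈ S, ∃ a', f a' = a := fun a ha => by
    have : a ∈ Set.range f := by rw [Finset.range_orderEmbOfFin]; exact ha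
    exact this
  have hpre : ∀ C ⊆ S, ∃ C' : Finset (Fin k), C'.card = C.card ∧ ∀ a, a ∈ C' ↔ f a ∈ C := by
    intro C hC
    refine ⟨Finset.univ.filter fun a => f a ∈ C, ?_, by simp⟩
    rw [← Finset.card_map f.toEmbedding]
    congr 1
    ext a
    simp only [Finset.mem_map, Finset.mem_filter, Finset.mem_univ, true_and]
    constructor
    · rintro ⟨b, hb, rfl⟩
      exact hb
    · intro ha
      obtain ⟨b, rfl⟩ := hrange a (hC ha)
      exact ⟨b, ha, rfl⟩
  obtain ⟨i', hi'⟩ := hrange i (by simp [hS])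
  obtain ⟨A', hA', hA''⟩ := hpre A fun a ha => by simp [hS, ha]
  obtain ⟨B', hB', hB''⟩ := hpre B fun a ha => by simp [hS, ha]
  refine ⟨π, ⟨f, f.strictMono, hπ⟩, i', A', B', by omega, by omega, fun a ha => ?_,
    fun a ha => ?_, fun a ha b hb hab => ?_, fun a ha b hb hab => ?_⟩
  · have := hA1 _ ((hA'' a).1 ha)
    rw [← hi'] at this
    exact ⟨f.lt_iff_lt.1 this.1, (hπ _ _).1 this.2⟩
  · have := hB1 _ ((hB'' a).1 ha)
    rw [← hi'] at this
    exact ⟨f.lt_iff_lt.1 this.1, (hπ _ _).1 this.2⟩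
  · exact (hπ _ _).1 (hA2 _ ((hA'' a).1 ha) _ ((hA'' b).1 hb) (f.lt_iff_lt.2 hab))
  · exact (hπ _ _).1 (hB2 _ ((hB'' a).1 ha) _ ((hB'' b).1 hb) (f.lt_iff_lt.2 hab))

/-! ### The Knuth class of the row superstandard hook -/

theorem mem_hook {i j : ℕ} : (i, j) ∈ hook r s ↔ i = 0 ∧ j < r ∨ i < s ∧ j = 0 := by
  change (i, j) ∈ ({0} : Finset ℕ) ×ˢ Finset.range r ∪ Finset.range s ×ˢ ({0} : Finset ℕ) ↔ _
  simp only [Finset.mem_union, Finset.mem_product, Finset.mem_singleton, Finset.mem_range]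

theorem card_hook (hr : 1 ≤ r) (hs : 1 ≤ s) : (hook r s).card + 1 = r + s := by
  have h := Finset.card_union_add_card_inter (({0} : Finset ℕ) ×ˢ Finset.range r)
    (Finset.range s ×ˢ ({0} : Finset ℕ))
  have h1 : (({0} : Finset ℕ) ×ˢ Finset.range r) ∩ (Finset.range s ×ˢ ({0} : Finset ℕ)) =
      {(0, 0)} := by
    ext ⟨i, j⟩
    simp only [Finset.mem_inter, Finset.mem_product, Finset.mem_singleton, Finset.mem_range,
      Prod.mk.injEq]
    omega
  rw [h1, Finset.card_singleton] at h
  refine h.trans ?_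
  simp

theorem eq_succ_of_strictMono {g : ℕ → ℕ} {N : ℕ} (hg : ∀ m, m + 1 < N → g m < g (m + 1))
    (h1 : ∀ m < N, 1 ≤ g m ∧ g m ≤ N) {m : ℕ} (hm : m < N) : g m = m + 1 := by
  have h2 : ∀ d m, m + d < N → g m + d ≤ g (m + d) := fun d m hd => by
    induction d with
    | zero => simp
    | succ d ih =>
      have := ih (by omega)
      have := hg (m + d) (by omega)
      change g m + (d + 1) ≤ g (m + d + 1)
      omega
  have h3 := h2 m 0 (by omega)
  have h4 := h2 (N - 1 - m) m (by omega)
  have h5 := h1 0 (by omega)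
  have h6 := h1 (m + (N - 1 - m)) (by omega)
  rw [zero_add] at h3
  omega

theorem strictMono_fin_add_le {k : ℕ} {g : Fin k → ℕ} (hg : StrictMono g) {i j : Fin k}
    (hij : i ≤ j) : g i + j ≤ g j + i := by
  obtain ⟨i, hi⟩ := i
  obtain ⟨j, hj⟩ := j
  obtain ⟨d, rfl⟩ := Nat.exists_eq_add_of_le (show i ≤ j from hij)
  induction d with
  | zero => exact le_rfl
  | succ d ih =>
    have h1 := ih (by omega) (Nat.le_add_right _ _)
    have h2 : g ⟨i + d, by omega⟩ < g ⟨i + (d + 1), hj⟩ := hg (by simp [Fin.lt_def])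
    simp only at h1 ⊢
    omega

/-- The cells of a hook, in the order of the entries of the row superstandard tableau. -/
def hookCell (r m : ℕ) : ℕ × ℕ := if m < r then (0, m) else (m + 1 - r, 0)

theorem hook_of_hasAscendingSequence {P : SYT μ} (hr : 1 ≤ r) (hs : 1 ≤ s)
    (hcard : μ.card + 1 = r + s) (h : P.HasAscendingSequence r s) :
    μ = hook r s ∧ ∀ m < μ.card, P.entry (hookCell r m).1 (hookCell r m).2 = m + 1 := by
  obtain ⟨c, h1, h2, h3, h4⟩ := h
  have hc0 := h2 ⟨0, by omega⟩ rfl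
  have hle : ∀ k : Fin s, (k : ℕ) ≤ (c k).1 := fun k => by
    have := strictMono_fin_add_le h3 (i := ⟨0, by omega⟩) (j := k) (Nat.zero_le _)
    simpa [hc0] using this
  have hμ : μ = hook r s := by
    refine YoungDiagram.ext (Finset.eq_of_subset_of_card_le ?_ ?_).symm
    · rintro ⟨i, j⟩ hij
      change (i, j) ∈ μ
      rcases mem_hook.1 hij with ⟨rfl, hj⟩ | ⟨hi, rfl⟩
      · exact μ.up_left_mem le_rfl (by omega : j ≤ r - 1) (hc0 ▸ h1 ⟨0, by omega⟩)
      · exact μ.up_left_mem (hle ⟨i, hi⟩) (Nat.zero_le _) (h1 ⟨i, hi⟩)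
    · have := card_hook hr hs
      change μ.card ≤ (hook r s).card
      omega
  have hsub : ∀ x ∈ μ, x ∈ hook r s := fun x hx => by rwa [hμ] at hx
  refine ⟨hμ, fun m hm => ?_⟩
  have hcell : ∀ m < μ.card, hookCell r m ∈ μ := fun m hm => by
    rw [hμ, hookCell]
    split_ifs with h
    · exact mem_hook.2 (by omega)
    · exact mem_hook.2 (by omega)
  refine eq_succ_of_strictMono (g := fun m => P.entry (hookCell r m).1 (hookCell r m).2)
    (N := μ.card) (fun m hm => ?_) (fun m hm => ⟨P.one_le_entry (hcell m hm),
      P.entry_le (hcell m hm)⟩) hm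
  have hm' := hcell (m + 1) hm
  rcases lt_trichotomy (m + 1) r with hmr | hmr | hmr
  · have e1 : hookCell r m = (0, m) := if_pos (by omega)
    have e2 : hookCell r (m + 1) = (0, m + 1) := if_pos hmr
    rw [e2] at hm'
    simpa only [e1, e2] using P.row_strict (Nat.lt_succ_self m) hm'
  · have e1 : hookCell r m = (0, r - 1) := by
      rw [hookCell, if_pos (by omega), ← hmr]
      rfl
    have e2 : hookCell r (m + 1) = (1, 0) := by
      rw [hookCell, if_neg (by omega)]
      congr
      omega
    have hs2 : 1 < s := by omega
    have hc1 : c ⟨1, hs2⟩ = (1, 0) := by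
      have h5 := strictMono_fin_add_le h3 (i := ⟨1, hs2⟩) (j := ⟨s - 1, by omega⟩)
        (by simp [Fin.le_def]; omega)
      have h6 := h1 ⟨s - 1, by omega⟩
      have h7 := h1 ⟨1, hs2⟩
      have h8 := hle ⟨1, hs2⟩
      have h9 := hle ⟨s - 1, by omega⟩
      have h6' := mem_hook.1 (hsub _ h6)
      have h7' := mem_hook.1 (hsub _ h7)
      simp only at h5 h8 h9
      refine Prod.ext ?_ ?_ <;> simp only <;> omega
    have h5 := h4 (show (⟨0, by omega⟩ : Fin s) < ⟨1, hs2⟩ by simp [Fin.lt_def])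
    simpa only [hc0, hc1, e1, e2] using h5
  · have e1 : hookCell r m = (m + 1 - r, 0) := if_neg (by omega)
    have e2 : hookCell r (m + 1) = (m + 1 + 1 - r, 0) := if_neg (by omega)
    rw [e2] at hm'
    simpa only [e1, e2] using P.col_strict (by omega) hm'

theorem hasAscendingSequence_rowSuperstandard (hr : 1 ≤ r) :
    (rowSuperstandard (hook r s)).HasAscendingSequence r s := by
  let c : Fin s → ℕ × ℕ := fun k => ((k : ℕ), if (k : ℕ) = 0 then r - 1 else 0)
  have hc : ∀ k, c k ∈ hook r s := fun k => by
    have := k.isLt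
    refine mem_hook.2 ?_
    split_ifs <;> omega
  refine ⟨c, hc, fun k hk => by simp [c, hk], fun i j h => h, fun i j h => ?_⟩
  have e : ∀ k, (rowSuperstandard (hook r s)).entry (c k).1 (c k).2 =
      rowOffset (hook r s) (c k).1 + (c k).2 + 1 := fun k => if_pos (hc k)
  simp only [e]
  exact Nat.succ_lt_succ (rowOffset_add_lt h (hc i))

theorem mem_knuthClass_hook (hr : 1 ≤ r) (hs : 1 ≤ s)
    {π : Equiv.Perm (Fin (hook r s).card)} :
    π ∈ knuthClass (rowSuperstandard (hook r s)) ↔ PermPeak r s π := by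
  rw [← hasPeak_iff_permPeak π hr hs]
  change (∀ i j, ent (insertionTableau π) i j = _) ↔ _
  constructor
  · intro h
    rw [← hasAscendingSequence_iff_hasPeak (hasRows_insertionTableau_iff.2 h) hr hs]
    exact hasAscendingSequence_rowSuperstandard hr
  · intro h
    obtain ⟨P, hP⟩ := exists_hasRows π (mem_ofRowLens_lengths (isTab_insertionTableau π))
    rw [← hasAscendingSequence_iff_hasPeak hP hr hs] at h
    have hcard := card_hook hr hs
    have hcard' := card_eq_of_hasRows hP
    obtain ⟨hμ, hentry⟩ := hook_of_hasAscendingSequence hr hs (by omega) h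
    have hentry' := (hook_of_hasAscendingSequence hr hs hcard
      (hasAscendingSequence_rowSuperstandard (s := s) hr)).2
    intro i j
    rw [hP.ent_eq]
    by_cases hij : (i, j) ∈ hook r s
    · obtain ⟨m, hm, hm'⟩ : ∃ m < (hook r s).card, hookCell r m = (i, j) := by
        rcases mem_hook.1 hij with ⟨rfl, hj⟩ | ⟨hi, rfl⟩
        · exact ⟨j, by omega, if_pos hj⟩
        · rcases Nat.eq_zero_or_pos i with rfl | hi0
          · exact ⟨0, by omega, if_pos (by omega)⟩
          · refine ⟨i + r - 1, by omega, ?_⟩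
            rw [hookCell, if_neg (by omega)]
            congr
            omega
      have e1 := hentry m (by omega)
      have e2 := hentry' m hm
      rw [hm'] at e1 e2
      exact e1.trans e2.symm
    · rw [SYT.zeros _ hij]
      exact P.zeros (by rwa [hμ])

/-- A permutation avoids the Knuth class of the row superstandard hook if and only if its
insertion tableau has no ascending sequence. -/
theorem mem_avoiders_knuthClass_hook (hr : 1 ≤ r) (hs : 1 ≤ s) {σ : Equiv.Perm (Fin n)}
    {P : SYT μ} (hP : P.HasRows (insertionTableau σ)) :
    σ ∈ avoiders n (knuthClass (rowSuperstandard (hook r s))) ↔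
      ¬ P.HasAscendingSequence r s := by
  rw [hasAscendingSequence_iff_hasPeak hP hr hs, hasPeak_iff_permPeak σ hr hs]
  simp only [avoiders, Finset.mem_filter, Finset.mem_univ, true_and, mem_knuthClass_hook hr hs]
  rw [← not_iff_not]
  push Not
  constructor
  · rintro ⟨π, hπ, hc⟩
    exact hπ.of_containsPattern hc
  · intro h
    obtain ⟨π, hc, hπ⟩ := h.exists_containsPattern (card_hook hr hs)
    exact ⟨π, hπ, hc⟩

/-! ### Robinson–Schensted–Knuth for labelled permutations -/

/-- `f` is one of the sequences of indices in the definition of `F_{Des σ}`. -/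
def Compatible (σ : Equiv.Perm (Fin n)) (f : Fin n → ℕ) : Prop :=
  Monotone f ∧ ∀ (j : ℕ) (h : j + 1 < n), j ∈ descentSet σ →
    f ⟨j, Nat.lt_of_succ_lt h⟩ < f ⟨j + 1, h⟩

theorem lexSorted_biword_iff {σ : Equiv.Perm (Fin n)} {f : Fin n → ℕ} :
    LexSorted (biword f σ) ↔ Compatible σ f := by
  rw [LexSorted, biword, List.pairwise_reverse, List.pairwise_ofFn]
  simp only [Nat.add_le_add_iff_right, Fin.val_fin_le]
  constructor
  · intro h
    refine ⟨fun i j hij => ?_, fun j hj hd => ?_⟩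
    · rcases hij.lt_or_eq with hij | rfl
      · rcases h hij with h1 | h1 <;> omega
      · exact le_rfl
    · obtain ⟨_, hd⟩ := hd
      rcases h (show (⟨j, Nat.lt_of_succ_lt hj⟩ : Fin n) < ⟨j + 1, hj⟩ by simp [Fin.lt_def])
        with h1 | h1
      · exact h1
      · exact absurd h1.2 (not_le.2 hd)
  · rintro ⟨h1, h2⟩ ⟨i, hi⟩ ⟨j, hj⟩ hij
    refine (h1 hij.le).lt_or_eq.imp id fun h => ⟨h, ?_⟩
    obtain ⟨d, rfl⟩ := Nat.exists_eq_add_of_le (show i ≤ j from le_of_lt hij)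
    clear hij
    induction d with
    | zero => exact le_rfl
    | succ d ih =>
      have h3 : f ⟨i, hi⟩ ≤ f ⟨i + d, by omega⟩ := h1 (by simp [Fin.le_def])
      have h4 : f ⟨i + d, by omega⟩ ≤ f ⟨i + (d + 1), hj⟩ := h1 (by simp [Fin.le_def])
      refine (ih (by omega) (by omega)).trans ?_
      by_contra h5
      have := h2 (i + d) hj ⟨hj, not_le.1 h5⟩
      have h6 : f ⟨i + d + 1, hj⟩ = f ⟨i + (d + 1), hj⟩ := rfl
      omega

theorem biword_injective {f f' : Fin n → ℕ} {σ σ' : Equiv.Perm (Fin n)}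
    (h : biword f σ = biword f' σ') : σ = σ' ∧ f = f' := by
  have h1 := congrFun (List.ofFn_injective (List.reverse_injective h))
  simp only [Prod.mk.injEq, Nat.add_right_cancel_iff] at h1
  exact ⟨Equiv.ext fun i => Fin.ext (h1 i).2, funext fun i => (h1 i).1⟩

theorem exists_eq_biword {L : List (ℕ × ℕ)} (hL : (L.map Prod.snd).Perm (List.range' 1 n)) :
    ∃ (σ : Equiv.Perm (Fin n)) (f : Fin n → ℕ), biword f σ = L := by
  have hlen : L.reverse.length = n := by simpa using hL.length_eq
  have hmem : ∀ i : Fin n, 1 ≤ (L.reverse[i]).2 ∧ (L.reverse[i]).2 < 1 + n := fun i => by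
    rw [← List.mem_range'_1]
    refine hL.subset (List.mem_map_of_mem ?_)
    exact List.mem_reverse.1 (List.getElem_mem _)
  have hnd : (L.reverse.map Prod.snd).Nodup := by
    rw [List.map_reverse, List.nodup_reverse]
    exact hL.nodup_iff.2 List.nodup_range'
  let g : Fin n → Fin n := fun i => ⟨(L.reverse[i]).2 - 1, by have := hmem i; omega⟩
  have hg : Function.Injective g := by
    intro i j hij
    have h1 : (L.reverse[i]).2 - 1 = (L.reverse[j]).2 - 1 := congrArg Fin.val hij
    have h2 := hmem i
    have h3 := hmem j
    have h4 : (L.reverse.map Prod.snd)[(i : ℕ)]'(by rw [List.length_map, hlen]; omega) =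
        (L.reverse.map Prod.snd)[(j : ℕ)]'(by rw [List.length_map, hlen]; omega) := by
      simp only [List.getElem_map]
      change (L.reverse[i]).2 = (L.reverse[j]).2
      omega
    exact Fin.ext ((List.Nodup.getElem_inj_iff hnd).1 h4)
  refine ⟨Equiv.ofBijective g (Finite.injective_iff_bijective.1 hg), fun i => (L.reverse[i]).1, ?_⟩
  rw [biword, List.reverse_eq_iff]
  refine List.ext_getElem (by simpa using hlen.symm) fun i h1 h2 => ?_
  have hi : i < n := by simpa using h1
  have := hmem ⟨i, hi⟩
  rw [List.getElem_ofFn]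
  refine Prod.ext rfl ?_
  change (L.reverse[(⟨i, hi⟩ : Fin n)]).2 - 1 + 1 = (L.reverse[(⟨i, hi⟩ : Fin n)]).2
  omega

theorem sum_biword {M : Type*} [AddCommMonoid M] (g : ℕ → M) (f : Fin n → ℕ)
    (σ : Equiv.Perm (Fin n)) : ((biword f σ).map fun p => g p.1).sum = ∑ j, g (f j) := by
  rw [biword, List.map_reverse, List.sum_reverse, List.map_ofFn, List.sum_ofFn]
  rfl

/-- The recording tableau of a biword, as a semistandard Young tableau. -/
def recordingTableau {L : List (ℕ × ℕ)} (hL : LexSorted L)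
    (hμ : ∀ i j, (i, j) ∈ μ ↔ j < len (insTab L) i) : SemistandardYoungTableau μ where
  entry := recTab L
  row_weak' hj h := (isFilling_recTab hL).row_le hj ((hμ _ _).1 h)
  col_strict' hi h := (isFilling_recTab hL).col_lt hi ((hμ _ _).1 h)
  zeros' h := recTab_eq_zero (by simpa [hμ] using h)

/-- The semistandard tableaux of shape `μ` and content `d`. -/
abbrev ContentTableau (μ : YoungDiagram) (d : ℕ →₀ ℕ) : Type :=
  {T : SemistandardYoungTableau μ // ∑ c ∈ μ.cells, Finsupp.single (T c.1 c.2) 1 = d}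

/-- The index sequences compatible with `σ` and of content `d`. -/
abbrev ContentSequence (σ : Equiv.Perm (Fin n)) (d : ℕ →₀ ℕ) : Type :=
  {f : Fin n → ℕ // Compatible σ f ∧ ∑ j, Finsupp.single (f j) 1 = d}

instance (σ : Equiv.Perm (Fin n)) (d : ℕ →₀ ℕ) : Finite (ContentSequence σ d) := by
  have h : ∀ (f : ContentSequence σ d) (j : Fin n), f.1 j ∈ d.support := by
    rintro ⟨f, -, hf⟩ j
    have h1 := DFunLike.congr_fun hf (f j)
    rw [Finsupp.finsetSum_apply] at h1
    rw [Finsupp.mem_support_iff]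
    have := Finset.single_le_sum (f := fun i => Finsupp.single (f i) 1 (f j))
      (fun i _ => Nat.zero_le _) (Finset.mem_univ j)
    simp only [Finsupp.single_eq_same] at this
    simp only
    omega
  refine Finite.of_injective
    (fun f j => (⟨f.1 j, h f j⟩ : d.support) : ContentSequence σ d → Fin n → d.support) ?_
  intro f g hfg
  exact Subtype.ext (funext fun j => congrArg Subtype.val (congrFun hfg j))

theorem card_sigma_contentSequence (P : SYT μ) (hμ : μ.card = n) (d : ℕ →₀ ℕ) :
    Nat.card (Σ σ : {σ : Equiv.Perm (Fin n) // P.HasRows (insertionTableau σ)},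
      ContentSequence σ.1 d) = Nat.card (ContentTableau μ d) := by
  have hmem : ∀ {σ : Equiv.Perm (Fin n)} (_ : P.HasRows (insertionTableau σ)) (f : Fin n → ℕ)
      (i j : ℕ), (i, j) ∈ μ ↔ j < len (insTab (biword f σ)) i := fun h f => by
    rw [insTab_biword]
    exact h.mem_iff
  let F : (Σ σ : {σ : Equiv.Perm (Fin n) // P.HasRows (insertionTableau σ)},
      ContentSequence σ.1 d) → ContentTableau μ d := fun x =>
    ⟨recordingTableau (lexSorted_biword_iff.2 x.2.2.1) (hmem x.1.2 x.2.1), by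
      refine Eq.trans ?_ ((sum_biword (fun a => Finsupp.single a 1) x.2.1 x.1.1).trans x.2.2.2)
      exact sum_recTab (fun a => Finsupp.single a 1) _ fun c => hmem x.1.2 x.2.1 c.1 c.2⟩
  refine Nat.card_congr (Equiv.ofBijective F ⟨?_, ?_⟩)
  · rintro ⟨⟨σ, hσ⟩, ⟨f, hf⟩⟩ ⟨⟨σ', hσ'⟩, ⟨f', hf'⟩⟩ h
    have h1 : recTab (biword f σ) = recTab (biword f' σ') :=
      congrArg (fun T : ContentTableau μ d => T.1.entry) h
    have h2 : insTab (biword f σ) = insTab (biword f' σ') := by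
      rw [insTab_biword, insTab_biword]
      exact hσ.unique hσ'
    obtain ⟨rfl, rfl⟩ := biword_injective
      (rsk_injective (lexSorted_biword_iff.2 hf.1) (lexSorted_biword_iff.2 hf'.1) h2 h1)
    rfl
  · rintro ⟨T, hT⟩
    have hP := P.hasRows_rows
    have hfill : IsFilling P.rows T :=
      ⟨fun hj h => T.row_weak hj ((hP.mem_iff _ _).2 h),
        fun hi h => T.col_strict hi ((hP.mem_iff _ _).2 h),
        fun h => T.zeros (by simpa [hP.mem_iff] using h)⟩
    obtain ⟨L, hL, h1, h2⟩ := rsk_surjective hP.isTab hfill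
    have hcard : L.length = n := by
      have h3 := sum_recTab (fun _ => 1) L (C := μ.cells) fun c => by
        rw [h1]
        exact hP.mem_iff c.1 c.2
      rw [Finset.sum_const, smul_eq_mul, mul_one] at h3
      rw [← hμ, YoungDiagram.card, h3]
      simp
    have hperm : (L.map Prod.snd).Perm (List.range' 1 n) := by
      have h3 := flatten_insTab_perm L
      rw [h1] at h3
      have h4 : List.range' 1 n ⊆ P.rows.flatten := fun a ha => by
        rw [List.mem_range'_1] at ha
        obtain ⟨⟨i, j⟩, hij, rfl⟩ := P.bijOn.surjOn
          (show a ∈ (Finset.Icc 1 μ.card : Set ℕ) by simp; omega)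
        change P.entry i j ∈ _
        rw [← hP.ent_eq]
        exact ent_mem_flatten ((hP.mem_iff _ _).1 hij)
      refine h3.symm.trans (List.Subperm.perm_of_length_le
        (List.subperm_of_subset List.nodup_range' h4) ?_).symm
      rw [h3.length_eq]
      simp [hcard]
    obtain ⟨σ, f, rfl⟩ := exists_eq_biword hperm
    have hσ : P.HasRows (insertionTableau σ) := by
      rw [← insTab_biword f, h1]
      exact hP
    refine ⟨⟨⟨σ, hσ⟩, ⟨f, lexSorted_biword_iff.1 hL, ?_⟩⟩, ?_⟩
    · rw [← hT, ← sum_biword (fun a => Finsupp.single a 1) f σ]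
      refine (sum_recTab (fun a => Finsupp.single a 1) _ fun c => hmem hσ f c.1 c.2).symm.trans ?_
      rw [h2]
    · refine Subtype.ext (SemistandardYoungTableau.ext fun i j => ?_)
      exact congrFun (congrFun h2 i) j

instance (μ : YoungDiagram) : Finite (SYT μ) := by
  refine Finite.of_injective (fun P (c : μ.cells) =>
    (⟨P.entry c.1.1 c.1.2, Nat.lt_succ_of_le (P.entry_le c.2)⟩ : Fin (μ.card + 1))) ?_
  intro P P' h
  refine SYT.ext (funext₂ fun i j => ?_)
  by_cases hij : (i, j) ∈ μ
  · exact congrArg Fin.val (congrFun h ⟨(i, j), hij⟩)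
  · rw [P.zeros hij, P'.zeros hij]

/-! ### Partitions and diagrams -/

theorem pos_of_mem_sort {p : n.Partition} : ∀ x ∈ p.parts.sort (· ≥ ·), 0 < x := fun _ hx =>
  p.parts_pos (Multiset.mem_sort _ |>.1 hx)

theorem rowLens_partitionDiagram (p : n.Partition) :
    (partitionDiagram p).rowLens = p.parts.sort (· ≥ ·) :=
  YoungDiagram.rowLens_ofRowLens_eq_self pos_of_mem_sort

theorem partitionDiagram_injective :
    Function.Injective (partitionDiagram : n.Partition → YoungDiagram) := fun p p' h => by
  have h1 := congrArg YoungDiagram.rowLens h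
  rw [rowLens_partitionDiagram, rowLens_partitionDiagram] at h1
  have h2 := congrArg (fun l : List ℕ => (l : Multiset ℕ)) h1
  simp only [Multiset.sort_eq] at h2
  exact Nat.Partition.ext h2

theorem card_partitionDiagram (p : n.Partition) : (partitionDiagram p).card = n := by
  have h : (partitionDiagram p).rowLens.sum = (partitionDiagram p).card := by
    rw [← rowOffset_colLen]
    rfl
  rw [← h, rowLens_partitionDiagram, ← Multiset.sum_coe, Multiset.sort_eq, p.parts_sum]

theorem exists_partition_hasRows (σ : Equiv.Perm (Fin n)) :
    ∃ (p : n.Partition) (P : SYT (partitionDiagram p)), P.HasRows (insertionTableau σ) := by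
  have ht := isTab_insertionTableau σ
  set t := insertionTableau σ with ht_def
  have hsum : (t.map List.length).sum = n := by
    rw [← List.length_flatten, (flatten_insertionTableau_perm σ).length_eq, List.length_range']
  let p : n.Partition := ⟨(t.map List.length : List ℕ), fun {i} hi => by
    obtain ⟨row, hrow, rfl⟩ := List.mem_map.1 (Multiset.mem_coe.1 hi)
    obtain ⟨k, hk, rfl⟩ := List.mem_iff_getElem.1 hrow
    simpa [len, hk] using ht.len_pos hk, by simpa using hsum⟩
  have hsort : p.parts.sort (· ≥ ·) = t.map List.length :=
    List.Perm.eq_of_sortedGE (p.parts.pairwise_sort (· ≥ ·)).sortedGE ht.sortedGE_lengths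
      (Multiset.coe_eq_coe.1 (Multiset.sort_eq _ _))
  refine ⟨p, exists_hasRows σ fun i j => ?_⟩
  rw [← mem_ofRowLens_lengths ht, partitionDiagram]
  simp only [hsort]

theorem SYT.HasRows.partition_unique {p p' : n.Partition} {P : SYT (partitionDiagram p)}
    {P' : SYT (partitionDiagram p')} {t : List (List ℕ)} (h : P.HasRows t) (h' : P'.HasRows t) :
    (⟨p, P⟩ : Σ p : n.Partition, SYT (partitionDiagram p)) = ⟨p', P'⟩ := by
  obtain rfl : p = p' := partitionDiagram_injective (SetLike.ext fun ⟨i, j⟩ =>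
    (h.mem_iff i j).trans (h'.mem_iff i j).symm)
  obtain rfl : P = P' := SYT.ext (funext₂ fun i j => (h.ent_eq i j).symm.trans (h'.ent_eq i j))
  rfl

open Classical in
/-- Sums over permutations can be computed Knuth class by Knuth class. -/
theorem sum_perm_eq_sum_sigma (N : Equiv.Perm (Fin n) → ℕ) :
    let _ := fun p : n.Partition => Fintype.ofFinite (SYT (partitionDiagram p))
    ∑ σ, N σ = ∑ p : n.Partition, ∑ P : SYT (partitionDiagram p),
      ∑ σ : {σ : Equiv.Perm (Fin n) // P.HasRows (insertionTableau σ)}, N σ.1 := by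
  let _ := fun p : n.Partition => Fintype.ofFinite (SYT (partitionDiagram p))
  have h1 : ∀ p : n.Partition, ∀ P : SYT (partitionDiagram p),
      ∑ σ : {σ : Equiv.Perm (Fin n) // P.HasRows (insertionTableau σ)}, N σ.1 =
        ∑ σ, if P.HasRows (insertionTableau σ) then N σ else 0 := fun p P => by
    rw [← Finset.sum_filter]
    exact (Finset.sum_subtype _ (by simp) _).symm
  simp only [h1]
  rw [← Fintype.sum_sigma' (fun (p : n.Partition) (P : SYT (partitionDiagram p)) =>
    ∑ σ, if P.HasRows (insertionTableau σ) then N σ else 0), Finset.sum_comm]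
  refine Finset.sum_congr rfl fun σ _ => ?_
  obtain ⟨p, P, hP⟩ := exists_partition_hasRows σ
  rw [Finset.sum_eq_single ⟨p, P⟩ (fun x _ hx => if_neg fun h => hx (h.partition_unique hP))
    (by simp), if_pos hP]

theorem sum_avoiders_card_contentSequence (hr : 1 ≤ r) (hs : 1 ≤ s) (d : ℕ →₀ ℕ) :
    ∑ σ ∈ avoiders n (knuthClass (rowSuperstandard (hook r s))), Nat.card (ContentSequence σ d) =
      ∑ p : n.Partition, avoidingCount r s (partitionDiagram p) *
        Nat.card (ContentTableau (partitionDiagram p) d) := by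
  classical
  let _ := fun p : n.Partition => Fintype.ofFinite (SYT (partitionDiagram p))
  set A := avoiders n (knuthClass (rowSuperstandard (hook r s))) with hA
  calc ∑ σ ∈ A, Nat.card (ContentSequence σ d)
      = ∑ σ, if σ ∈ A then Nat.card (ContentSequence σ d) else 0 := by simp
    _ = ∑ p : n.Partition, ∑ P : SYT (partitionDiagram p),
          if ¬ P.HasAscendingSequence r s then
            Nat.card (ContentTableau (partitionDiagram p) d) else 0 := by
        rw [sum_perm_eq_sum_sigma]
        refine Finset.sum_congr rfl fun p _ => Finset.sum_congr rfl fun P _ => ?_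
        simp only [fun σ : {σ : Equiv.Perm (Fin n) // P.HasRows (insertionTableau σ)} =>
          mem_avoiders_knuthClass_hook hr hs σ.2, hA]
        by_cases h : P.HasAscendingSequence r s
        · simp [h]
        · simp only [h, not_false_eq_true, if_true]
          rw [← card_sigma_contentSequence P (card_partitionDiagram p) d, Nat.card_sigma]
    _ = _ := by
        refine Finset.sum_congr rfl fun p _ => ?_
        have h : avoidingCount r s (partitionDiagram p) = (Finset.univ.filter
            fun P : SYT (partitionDiagram p) => ¬ P.HasAscendingSequence r s).card := by
          rw [avoidingCount, Nat.card_eq_fintype_card, Fintype.card_subtype]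
        rw [← Finset.sum_filter, Finset.sum_const, smul_eq_mul, h]

end HookExpansion

theorem mainTheorem3 (r s : ℕ) (hr : 1 ≤ r) (hs : 1 ≤ s) (n : ℕ) :
    HookExpansion.Q n (HookExpansion.knuthClass
        (HookExpansion.rowSuperstandard (HookExpansion.hook r s))) =
      ∑ p : n.Partition,
        (HookExpansion.avoidingCount r s (HookExpansion.partitionDiagram p) : ℝ) •
          HookExpansion.schur (HookExpansion.partitionDiagram p) := by
  refine MvPowerSeries.ext fun d => ?_
  have h := congrArg (Nat.cast : ℕ → ℝ)
    (HookExpansion.sum_avoiders_card_contentSequence (n := n) hr hs d)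
  push_cast at h
  rw [HookExpansion.Q, map_sum, map_sum]
  simp only [map_smul, smul_eq_mul]
  refine Eq.trans (Finset.sum_congr rfl fun σ _ => ?_) h
  change (Nat.card _ : ℝ) = _
  simp only [HookExpansion.ContentSequence, HookExpansion.Compatible, and_assoc]
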